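/- Let $k$ be a field and let $q\in k$, $q\neq 0$. Let $A=\mathbb C_q^2$ be the quantum-braided plane over $k$: the algebra with generators $x,y$ and relation $yx=qxy$, with basis $e_{(m,n)}=x^my^n$ ($m,n\ge 0$), so that $e_{(i,j)}e_{(k,l)}=q^{jk}e_{(i+k,j+l)}$, and with the braiding $\Psi:A\otimes A\to A\otimes A$ given by $$\Psi(x\otimes x)=q^2x\otimes x,\quad \Psi(y\otimes y)=q^2y\otimes y,\quad \Psi(x\otimes y)=q\,y\otimes x,\quad \Psi(y\otimes x)=q\,x\otimes y+(q^2-1)\,y\otimes x,$$ $\Psi(1\otimes a)=a\otimes 1$, $\Psi(a\otimes 1)=1\otimes a$, and extended to all of $A\otimes A$ by functoriality, $$\Psi(ab\otimes c)=(\mathrm{id}\otimes\cdot)(\Psi\otimes\mathrm{id})(\mathrm{id}\otimes\Psi)(a\otimes b\otimes c),\qquad \Psi(a\otimes bc)=(\cdot\otimes\mathrm{id})(\mathrm{id}\otimes\Psi)(\Psi\otimes\mathrm{id})(a\otimes b\otimes c).$$ Write $\Psi(e_I\otimes e_J)=\sum_{K,L}R^{K}{}_{I}{}^{L}{}_{J}\,e_L\otimes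 e_K$, where $I,J,K,L\in\mathbb Z_{\ge0}^2$, and $|(i,j)|=i+j$; $\Psi$ preserves the degree of each factor, so $R^{K}{}_{I}{}^{L}{}_{J}=0$ unless $|K|=|I|$ and $|L|=|J|$. The restricted dual-quasitriangular comeasuring bialgebra $M_0(R,\mathbb C_q^2)$ is the algebra generated by $1$ and $t^I{}_J$ ($I,J\in\mathbb Z_{\ge 0}^2$) with the relations $$\sum_{(a,b)+(c,d)=(m,n)}q^{bc}\,t^{(a,b)}{}_{(i,j)}\,t^{(c,d)}{}_{(k,l)}=q^{jk}\,t^{(m,n)}{}_{(i+k,j+l)},\qquad \sum_{A,B}R^I{}_A{}^J{}_B\,t^A{}_K t^B{}_L=\sum_{A,B}t^J{}_Bt^I{}_A\,R^A{}_K{}^B{}_L,$$ $$t^{0}{}_{0}=1,\qquad t^I{}_0=t^0{}_I=0\quad(I\ne 0),$$ with coproduct $\Delta t^I{}_J=\sum_A t^I{}_A\otimes t^A{}_J$ (a finite sum, as $t^I{}_A=0$ if $|A|>|I|$) and counit $\varepsilon(t^I{}_J)=\delta^I_J$. Put $s_I=t^I{}_{(1,0)}$ and $t_I=t^I{}_{(0,1)}$.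 Let $M_q(2)$ be the bialgebra of $2\times2$ quantum matrices, generated by $a,b,c,d$ with $$ba=qab,\quad ca=qac,\quad db=qbd,\quad dc=qcd,\quad cb=bc,\quad da-ad=(q-q^{-1})bc$$ and with the matrix coproduct and counit for $\mathbf m=\begin{pmatrix}a&b\\c&d\end{pmatrix}=(m^i{}_j)$. A dual quasitriangular structure on a bialgebra $H$ is a convolution-invertible bilinear form $\mathcal R$ on $H$ such that $$\mathcal R(fg,h)=\mathcal R(f,h_{(1)})\mathcal R(g,h_{(2)}),\quad \mathcal R(f,gh)=\mathcal R(f_{(1)},h)\mathcal R(f_{(2)},g),\quad g_{(1)}f_{(1)}\mathcal R(f_{(2)},g_{(2)})=\mathcal R(f_{(1)},g_{(1)})f_{(2)}g_{(2)}.$$ Then the following hold. 1. There is a surjective bialgebra map $p:M_0(R,\mathbb C_q^2)\to M_q(2)$ with $\begin{pmatrix}s_{(1,0)}&t_{(1,0)}\\ s_{(0,1)}&t_{(0,1)}\end{pmatrix}\mapsto\begin{pmatrix}a&b\\c&d\end{pmatrix}$ and $p(s_I)=p(t_I)=0$ for $|I|\ge2$. 2. There is an injective bialgebra map $\iota:M_q(2)\to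 M_0(R,\mathbb C_q^2)$ with $\begin{pmatrix}a&b\\c&d\end{pmatrix}\mapsto\begin{pmatrix}s_{(1,0)}&t_{(1,0)}\\ s_{(0,1)}&t_{(0,1)}\end{pmatrix}$, whose image is the subalgebra generated by these four lowest-level generators, and $p\circ\iota=\mathrm{id}$. 3. $M_0(R,\mathbb C_q^2)$ has a dual quasitriangular structure $\mathcal R$ with $\mathcal R(t^I{}_J,t^K{}_L)=R^I{}_J{}^K{}_L$ for all $I,J,K,L$, and $M_q(2)$ has a dual quasitriangular structure $\mathcal R_2$ with $\mathcal R_2(m^i{}_j,m^k{}_l)=(R_{su_2})^i{}_j{}^k{}_l$, where the nonzero entries of $R_{su_2}$ are $R^1{}_1{}^1{}_1=R^2{}_2{}^2{}_2=q^2$, $R^1{}_1{}^2{}_2=R^2{}_2{}^1{}_1=q$, $R^1{}_2{}^2{}_1=q^2-1$. The first extends the second: $\mathcal R(\iota(f),\iota(g))=\mathcal R_2(f,g)$ for all $f,g\in M_q(2)$. -/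

import Mathlib

open scoped TensorProduct

namespace QuantumPlane

section
variable {k : Type*} [Field k]

/-- The single defining relation `y x = q x y` of the quantum plane (`x`, `y` are the
generators `0`, `1` of the free algebra). -/
inductive PlaneRel (q : kˣ) : FreeAlgebra k (Fin 2) → FreeAlgebra k (Fin 2) → Prop
  | yx : PlaneRel q (FreeAlgebra.ι k 1 * FreeAlgebra.ι k 0)
      ((q : k) • (FreeAlgebra.ι k 0 * FreeAlgebra.ι k 1))

/-- The quantum plane `k⟨x, y⟩ / (y x = q x y)`. -/
abbrev Plane (q : kˣ) : Type _ := RingQuot (PlaneRel q)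

/-- The coordinates `x = coord q 0` and `y = coord q 1`. -/
noncomputable def coord (q : kˣ) (i : Fin 2) : Plane q :=
  RingQuot.mkAlgHom k (PlaneRel q) (FreeAlgebra.ι k i)

theorem coord_rel (q : kˣ) : coord q 1 * coord q 0 = (q : k) • (coord q 0 * coord q 1) := by
  have h := RingQuot.mkAlgHom_rel k (PlaneRel.yx (q := q))
  simpa [coord] using h

/-- The universal property of the quantum plane. -/
noncomputable def planeLift (q : kˣ) {B : Type*} [Ring B] [Algebra k B] (f : Fin 2 → B)
    (hf : f 1 * f 0 = (q : k) • (f 0 * f 1)) : Plane q →ₐ[k] B :=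
  RingQuot.liftAlgHom k ⟨FreeAlgebra.lift k f, by
    rintro _ _ ⟨⟩
    simpa using hf⟩

@[simp] theorem planeLift_coord (q : kˣ) {B : Type*} [Ring B] [Algebra k B] (f : Fin 2 → B)
    (hf : f 1 * f 0 = (q : k) • (f 0 * f 1)) (i : Fin 2) :
    planeLift q f hf (coord q i) = f i := by
  simp [planeLift, coord, RingQuot.liftAlgHom_mkAlgHom_apply]

theorem plane_induction (q : kˣ) {P : Plane q → Prop}
    (h_scalar : ∀ c, P (algebraMap k _ c)) (h_coord : ∀ i, P (coord q i))
    (h_mul : ∀ a b, P a → P b → P (a * b)) (h_add : ∀ a b, P a → P b → P (a + b))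
    (a : Plane q) : P a := by
  obtain ⟨a, rfl⟩ := RingQuot.mkAlgHom_surjective k (PlaneRel q) a
  induction a using FreeAlgebra.induction with
  | grade0 r => simpa using h_scalar r
  | grade1 i => exact h_coord i
  | mul a b ha hb => simpa using h_mul _ _ ha hb
  | add a b ha hb => simpa using h_add _ _ ha hb

/-- The monomial `e_{(m,n)} = x ^ m * y ^ n`. -/
noncomputable def mono (q : kˣ) (i : ℕ × ℕ) : Plane q := coord q 0 ^ i.1 * coord q 1 ^ i.2

theorem coord_one_mul_pow (q : kˣ) (m : ℕ) :
    coord q 1 * coord q 0 ^ m = ((q : k) ^ m) • (coord q 0 ^ m * coord q 1) := by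
  induction m with
  | zero => simp
  | succ m ih =>
    rw [pow_succ, ← mul_assoc, ih, smul_mul_assoc, mul_assoc, coord_rel, mul_smul_comm, smul_smul,
      pow_succ, mul_assoc]

theorem pow_mul_pow (q : kˣ) (n m : ℕ) :
    coord q 1 ^ n * coord q 0 ^ m = ((q : k) ^ (n * m)) • (coord q 0 ^ m * coord q 1 ^ n) := by
  induction n with
  | zero => simp
  | succ n ih =>
    rw [pow_succ, mul_assoc, coord_one_mul_pow, mul_smul_comm, ← mul_assoc, ih, smul_mul_assoc,
      smul_smul, mul_assoc, ← pow_add]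
    congr 2
    ring

/-- The structure constants of the quantum plane:
`e_{(i,j)} e_{(k,l)} = q ^ (j k) e_{(i+k,j+l)}`. -/
theorem mono_mul (q : kˣ) (i j : ℕ × ℕ) :
    mono q i * mono q j = ((q : k) ^ (i.2 * j.1)) • mono q (i + j) := by
  simp only [mono, Prod.fst_add, Prod.snd_add]
  rw [mul_assoc, ← mul_assoc (coord q 1 ^ i.2), pow_mul_pow, smul_mul_assoc, mul_smul_comm,
    pow_add, pow_add]
  simp only [mul_assoc]

/-- Left multiplication by `x` and `y` in the basis of monomials. -/
noncomputable def planeRep (q : kˣ) : Plane q →ₐ[k] Module.End k ((ℕ × ℕ) →₀ k) :=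
  planeLift q
    ![Finsupp.linearCombination k fun i : ℕ × ℕ => Finsupp.single (i.1 + 1, i.2) 1,
      Finsupp.linearCombination k fun i : ℕ × ℕ => Finsupp.single (i.1, i.2 + 1) ((q : k) ^ i.1)] (by
    ext i
    simp [Module.End.mul_apply, pow_succ, mul_comm])

theorem planeRep_mono (q : kˣ) (i : ℕ × ℕ) :
    planeRep q (mono q i) (Finsupp.single (0, 0) 1) = Finsupp.single i 1 := by
  have hy : ∀ n, planeRep q (coord q 1 ^ n) (Finsupp.single (0, 0) 1)
      = Finsupp.single (0, n) 1 := by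
    intro n
    induction n with
    | zero => simp
    | succ n ih => rw [pow_succ', map_mul, Module.End.mul_apply, ih]; simp [planeRep]
  have hx : ∀ m, planeRep q (coord q 0 ^ m) (Finsupp.single (0, i.2) 1)
      = Finsupp.single (m, i.2) 1 := by
    intro n
    induction n with
    | zero => simp
    | succ n ih => rw [pow_succ', map_mul, Module.End.mul_apply, ih]; simp [planeRep]
  rw [mono, map_mul, Module.End.mul_apply, hy, hx]

theorem mono_zero (q : kˣ) : mono q (0, 0) = 1 := by simp [mono]

theorem coord_zero_eq (q : kˣ) : coord q 0 = mono q (1, 0) := by simp [mono]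

theorem coord_one_eq (q : kˣ) : coord q 1 = mono q (0, 1) := by simp [mono]

/-- The monomials `x ^ m * y ^ n` form a basis of the quantum plane. -/
noncomputable def planeBasis (q : kˣ) : Module.Basis (ℕ × ℕ) k (Plane q) :=
  Module.Basis.mk (v := mono q)
    (by
      let f : Plane q →ₗ[k] ((ℕ × ℕ) →₀ k) :=
        (LinearMap.applyₗ (Finsupp.single (0, 0) 1)) ∘ₗ (planeRep q).toLinearMap
      have h : LinearIndependent k (f ∘ mono q) := by
        have : f ∘ mono q = fun i => Finsupp.single i (1 : k) := by
          funext i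
          exact planeRep_mono q i
        rw [this]
        exact (Finsupp.basisSingleOne (R := k) (ι := ℕ × ℕ)).linearIndependent
      exact LinearIndependent.of_comp f h)
    (by
      intro a _
      induction a using plane_induction with
      | h_scalar c =>
        rw [Algebra.algebraMap_eq_smul_one, ← mono_zero q]
        exact Submodule.smul_mem _ _ (Submodule.subset_span ⟨_, rfl⟩)
      | h_coord i =>
        fin_cases i
        · exact Submodule.subset_span ⟨(1, 0), (coord_zero_eq q).symm⟩
        · exact Submodule.subset_span ⟨(0, 1), (coord_one_eq q).symm⟩
      | h_mul a b ha hb =>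
        have h := Submodule.mul_mem_mul (ha trivial) (hb trivial)
        rw [Submodule.span_mul_span] at h
        refine Submodule.span_le.2 ?_ h
        rintro _ ⟨_, ⟨i, rfl⟩, _, ⟨j, rfl⟩, rfl⟩
        simp only [mono_mul]
        exact Submodule.smul_mem _ _ (Submodule.subset_span ⟨_, rfl⟩)
      | h_add a b ha hb => exact Submodule.add_mem _ (ha trivial) (hb trivial))

@[simp] theorem planeBasis_apply (q : kˣ) (i : ℕ × ℕ) : planeBasis q i = mono q i := by
  simp [planeBasis]

/-- For each `i`, the braiding with the coordinate `x_i` on the right has the form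
`Ψ (a ⊗ x_i) = ∑ j, x_j ⊗ Θ(a)_{j i}`.  Functoriality of `Ψ` in its first argument says that
`Θ` is an algebra map into the `2 × 2` matrices over the plane; the entries of
`Θ x` and `Θ y` are the prescribed values of `Ψ` on the coordinates. -/
noncomputable def braidGen (q : kˣ) : Plane q →ₐ[k] Matrix (Fin 2) (Fin 2) (Plane q) :=
  planeLift q
    ![!![(q : k) ^ 2 • coord q 0, 0; 0, (q : k) • coord q 0],
      !![(q : k) • coord q 1, 0; ((q : k) ^ 2 - 1) • coord q 0, (q : k) ^ 2 • coord q 1]] (by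
    ext i j
    fin_cases i <;> fin_cases j <;>
      simp [Matrix.mul_apply, Fin.sum_univ_two, smul_smul, coord_rel] <;> congr 1 <;> ring)

theorem braidGen_x (q : kˣ) : braidGen q (coord q 0) =
    !![(q : k) ^ 2 • coord q 0, 0; 0, (q : k) • coord q 0] := by
  simp [braidGen]

theorem braidGen_y (q : kˣ) : braidGen q (coord q 1) =
    !![(q : k) • coord q 1, 0; ((q : k) ^ 2 - 1) • coord q 0, (q : k) ^ 2 • coord q 1] := by
  simp [braidGen]

/-- The linear operator `a ↦ Θ(a)_{j i}` on the plane. -/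
noncomputable def braidOp (q : kˣ) (j i : Fin 2) : Module.End k (Plane q) where
  toFun a := braidGen q a j i
  map_add' a b := by simp
  map_smul' c a := by simp

theorem braidOp_one (q : kˣ) (j i : Fin 2) : braidOp q j i 1 = if j = i then 1 else 0 := by
  simp [braidOp, Matrix.one_apply]

theorem braidOp_mul (q : kˣ) (j i : Fin 2) (a b : Plane q) :
    braidOp q j i (a * b) = braidOp q j 0 a * braidOp q 0 i b + braidOp q j 1 a * braidOp q 1 i b := by
  simp [braidOp, Matrix.mul_apply, Fin.sum_univ_two]

theorem braidOp_algebraMap (q : kˣ) (j i : Fin 2) (c : k) :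
    braidOp q j i (algebraMap k _ c) = if j = i then algebraMap k _ c else 0 := by
  rw [Algebra.algebraMap_eq_smul_one, map_smul, braidOp_one]
  split_ifs <;> simp

theorem braidOp_zero_one (q : kˣ) (a : Plane q) : braidOp q 0 1 a = 0 := by
  induction a using plane_induction with
  | h_scalar c => simp [braidOp_algebraMap]
  | h_coord i => fin_cases i <;> simp [braidOp, braidGen_x, braidGen_y]
  | h_mul a b ha hb => simp [braidOp_mul, ha, hb]
  | h_add a b ha hb => simp [ha, hb]

theorem braidOp_comm (q : kˣ) (a : Plane q) :
    braidOp q 0 0 (braidOp q 1 1 a) = braidOp q 1 1 (braidOp q 0 0 a) := by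
  induction a using plane_induction with
  | h_scalar c => simp [braidOp_algebraMap]
  | h_coord i =>
    fin_cases i <;> simp [braidOp, braidGen_x, braidGen_y, smul_smul, mul_comm]
  | h_mul a b ha hb => simp [braidOp_mul, ha, hb, braidOp_zero_one]
  | h_add a b ha hb => simp [ha, hb]

theorem braidOp_qcomm (q : kˣ) (a : Plane q) :
    braidOp q 1 0 (braidOp q 1 1 a) = (q : k) • braidOp q 1 1 (braidOp q 1 0 a) := by
  induction a using plane_induction with
  | h_scalar c => simp [braidOp_algebraMap]
  | h_coord i =>
    fin_cases i <;> simp [braidOp, braidGen_x, braidGen_y, smul_smul] <;> congr 1 <;> ring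
  | h_mul a b ha hb => simp [braidOp_mul, ha, hb, braidOp_zero_one, braidOp_comm]
  | h_add a b ha hb => simp [ha, hb]

/-- The map `b ↦ ∑ b' ⊗ φ` with `Ψ (a ⊗ b) = ∑ b' ⊗ φ a`.  Functoriality of `Ψ` in its second
argument says that it is an algebra map into `A ⊗ End(A)ᵒᵖ`. -/
noncomputable def braidRight (q : kˣ) :
    Plane q →ₐ[k] Plane q ⊗[k] (Module.End k (Plane q))ᵐᵒᵖ :=
  planeLift q (fun i => ∑ j, coord q j ⊗ₜ[k] MulOpposite.op (braidOp q j i)) (by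
    have h01 : braidOp q 0 1 = 0 := LinearMap.ext (braidOp_zero_one q)
    have hc : braidOp q 0 0 * braidOp q 1 1 = braidOp q 1 1 * braidOp q 0 0 :=
      LinearMap.ext (braidOp_comm q)
    have hq : braidOp q 1 0 * braidOp q 1 1 = (q : k) • (braidOp q 1 1 * braidOp q 1 0) :=
      LinearMap.ext (braidOp_qcomm q)
    simp only [Fin.sum_univ_two, h01, MulOpposite.op_zero, TensorProduct.tmul_zero, zero_add,
      mul_add, add_mul, Algebra.TensorProduct.tmul_mul_tmul, ← MulOpposite.op_mul, hc, hq,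
      coord_rel, smul_add, MulOpposite.op_smul, TensorProduct.tmul_smul, TensorProduct.smul_tmul'])

/-- The braiding `Ψ : A ⊗ A → A ⊗ A` of the quantum plane. -/
noncomputable def braiding (q : kˣ) : Plane q ⊗[k] Plane q →ₗ[k] Plane q ⊗[k] Plane q :=
  TensorProduct.lift (LinearMap.mk₂ k
    (fun a b => LinearMap.lTensor (Plane q)
      ((LinearMap.applyₗ a) ∘ₗ (MulOpposite.opLinearEquiv k).symm.toLinearMap) (braidRight q b))
    (by
      intro a a' b
      simp only [map_add, LinearMap.add_comp, LinearMap.lTensor_add, LinearMap.add_apply])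
    (by
      intro c a b
      simp only [map_smul, LinearMap.smul_comp, LinearMap.lTensor_smul, LinearMap.smul_apply])
    (by
      intro a b b'
      simp only [map_add])
    (by
      intro c a b
      simp only [map_smul]))

theorem braiding_tmul (q : kˣ) (a b : Plane q) : braiding q (a ⊗ₜ b) =
    LinearMap.lTensor (Plane q)
      ((LinearMap.applyₗ a) ∘ₗ (MulOpposite.opLinearEquiv k).symm.toLinearMap)
      (braidRight q b) := by
  simp only [braiding, TensorProduct.lift.tmul, LinearMap.mk₂_apply]

theorem braiding_coord (q : kˣ) (a : Plane q) (i : Fin 2) :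
    braiding q (a ⊗ₜ coord q i) = ∑ j, coord q j ⊗ₜ[k] braidOp q j i a := by
  simp [braiding_tmul, braidRight, -Fin.sum_univ_two]

/-- `Ψ (a ⊗ 1) = 1 ⊗ a`. -/
theorem braiding_one_right (q : kˣ) (a : Plane q) :
    braiding q (a ⊗ₜ[k] 1) = 1 ⊗ₜ[k] a := by
  rw [braiding_tmul, show braidRight q 1 = 1 from (braidRight q).toRingHom.map_one,
    Algebra.TensorProduct.one_def, LinearMap.lTensor_tmul]
  simp

/-- The values of `Ψ` on the coordinates. -/
theorem braiding_coord_coord (q : kˣ) :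
    braiding q (coord q 0 ⊗ₜ[k] coord q 0) = (q : k) ^ 2 • (coord q 0 ⊗ₜ[k] coord q 0) ∧
    braiding q (coord q 1 ⊗ₜ[k] coord q 1) = (q : k) ^ 2 • (coord q 1 ⊗ₜ[k] coord q 1) ∧
    braiding q (coord q 0 ⊗ₜ[k] coord q 1) = (q : k) • (coord q 1 ⊗ₜ[k] coord q 0) ∧
    braiding q (coord q 1 ⊗ₜ[k] coord q 0) = (q : k) • (coord q 0 ⊗ₜ[k] coord q 1)
      + ((q : k) ^ 2 - 1) • (coord q 1 ⊗ₜ[k] coord q 0) := by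
  simp [braiding_coord, Fin.sum_univ_two, braidOp, braidGen_x, braidGen_y]

/-- The map `u ⊗ v ↦ (· ⊗ id) (id ⊗ Ψ) (u ⊗ v ⊗ c)`. -/
noncomputable def pushRight (q : kˣ) (c : Plane q) :
    Plane q ⊗[k] Plane q →ₗ[k] Plane q ⊗[k] Plane q :=
  (LinearMap.mul' k (Plane q)).rTensor (Plane q) ∘ₗ
    (TensorProduct.assoc k (Plane q) (Plane q) (Plane q)).symm.toLinearMap ∘ₗ
      (braiding q).lTensor (Plane q) ∘ₗ
        (TensorProduct.assoc k (Plane q) (Plane q) (Plane q)).toLinearMap ∘ₗ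
          (TensorProduct.mk k (Plane q ⊗[k] Plane q) (Plane q)).flip c

/-- The map `u ⊗ v ↦ (id ⊗ ·) (Ψ ⊗ id) (a ⊗ u ⊗ v)`. -/
noncomputable def pushLeft (q : kˣ) (a : Plane q) :
    Plane q ⊗[k] Plane q →ₗ[k] Plane q ⊗[k] Plane q :=
  (LinearMap.mul' k (Plane q)).lTensor (Plane q) ∘ₗ
    (TensorProduct.assoc k (Plane q) (Plane q) (Plane q)).toLinearMap ∘ₗ
      (braiding q).rTensor (Plane q) ∘ₗ
        (TensorProduct.assoc k (Plane q) (Plane q) (Plane q)).symm.toLinearMap ∘ₗ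
          TensorProduct.mk k (Plane q) (Plane q ⊗[k] Plane q) a

theorem pushRight_tmul (q : kˣ) (c u v : Plane q) : pushRight q c (u ⊗ₜ[k] v) =
    (LinearMap.mulLeft k u).rTensor (Plane q) (braiding q (v ⊗ₜ[k] c)) := by
  simp only [pushRight, LinearMap.comp_apply, LinearEquiv.coe_coe, LinearMap.flip_apply,
    TensorProduct.mk_apply, TensorProduct.assoc_tmul, LinearMap.lTensor_tmul]
  induction braiding q (v ⊗ₜ[k] c) with
  | zero => simp
  | tmul x y => simp
  | add x y hx hy => rw [TensorProduct.tmul_add]; simp only [map_add, hx, hy]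

theorem pushLeft_tmul (q : kˣ) (a u v : Plane q) : pushLeft q a (u ⊗ₜ[k] v) =
    (LinearMap.mulRight k v).lTensor (Plane q) (braiding q (a ⊗ₜ[k] u)) := by
  simp only [pushLeft, LinearMap.comp_apply, LinearEquiv.coe_coe,
    TensorProduct.mk_apply, TensorProduct.assoc_symm_tmul, LinearMap.rTensor_tmul]
  induction braiding q (a ⊗ₜ[k] u) with
  | zero => simp
  | tmul x y => simp
  | add x y hx hy => rw [TensorProduct.add_tmul]; simp only [map_add, hx, hy]

/-- Functoriality in the second argument:
`Ψ (a ⊗ b c) = (· ⊗ id) (id ⊗ Ψ) (Ψ ⊗ id) (a ⊗ b ⊗ c)`. -/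
theorem braiding_mul_right (q : kˣ) (a b c : Plane q) :
    braiding q (a ⊗ₜ[k] (b * c)) = pushRight q c (braiding q (a ⊗ₜ[k] b)) := by
  rw [braiding_tmul, braiding_tmul, map_mul]
  induction braidRight q b with
  | zero => simp
  | add u v hu hv => rw [add_mul]; simp only [map_add, hu, hv]
  | tmul b' φ =>
    rw [LinearMap.lTensor_tmul, pushRight_tmul, braiding_tmul]
    induction braidRight q c with
    | zero => simp
    | add u v hu hv => rw [mul_add]; simp only [map_add, hu, hv]
    | tmul c' ψ => simp [Module.End.mul_apply]

/-- Functoriality in the first argument: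
`Ψ (a b ⊗ c) = (id ⊗ ·) (Ψ ⊗ id) (id ⊗ Ψ) (a ⊗ b ⊗ c)`. -/
theorem braiding_mul_left (q : kˣ) (a b c : Plane q) :
    braiding q ((a * b) ⊗ₜ[k] c) = pushLeft q a (braiding q (b ⊗ₜ[k] c)) := by
  induction c using plane_induction generalizing a b with
  | h_scalar r =>
    simp only [Algebra.algebraMap_eq_smul_one, TensorProduct.tmul_smul, map_smul,
      braiding_one_right, pushLeft_tmul, LinearMap.lTensor_tmul, LinearMap.mulRight_apply]
  | h_coord i =>
    simp only [braiding_coord, Fin.sum_univ_two, map_add, pushLeft_tmul, LinearMap.lTensor_tmul,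
      LinearMap.mulRight_apply, braidOp_mul, TensorProduct.tmul_add]
    fin_cases i <;> simp <;> abel
  | h_add c c' h h' => simp only [TensorProduct.tmul_add, map_add, h, h']
  | h_mul c c' h h' =>
    rw [braiding_mul_right, h, braiding_mul_right]
    induction braiding q (b ⊗ₜ[k] c) with
    | zero => simp
    | add z w hz hw => simp only [map_add, hz, hw]
    | tmul u v =>
      obtain ⟨S, hS⟩ := TensorProduct.exists_finset (braiding q (a ⊗ₜ[k] u))
      obtain ⟨T, hT⟩ := TensorProduct.exists_finset (braiding q (v ⊗ₜ[k] c'))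
      rw [pushLeft_tmul, pushRight_tmul, hS, hT]
      simp only [map_sum, LinearMap.lTensor_tmul, LinearMap.rTensor_tmul, pushRight_tmul,
        pushLeft_tmul, LinearMap.mulRight_apply, LinearMap.mulLeft_apply, h', hT,
        braiding_mul_right, hS]
      rw [Finset.sum_comm]
      refine Finset.sum_congr rfl fun j _ => Finset.sum_congr rfl fun i _ => ?_
      induction braiding q (i.2 ⊗ₜ[k] j.1) with
      | zero => simp
      | add z w hz hw => simp only [map_add, hz, hw]
      | tmul x y => simp

/-- `Ψ (1 ⊗ a) = a ⊗ 1`. -/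
theorem braiding_one_left (q : kˣ) (a : Plane q) :
    braiding q (1 ⊗ₜ[k] a) = a ⊗ₜ[k] 1 := by
  induction a using plane_induction with
  | h_scalar r =>
    simp only [Algebra.algebraMap_eq_smul_one, TensorProduct.tmul_smul,
      braiding_one_right, TensorProduct.smul_tmul']
  | h_coord i =>
    simp only [braiding_coord, Fin.sum_univ_two, braidOp_one]
    fin_cases i <;> simp
  | h_add c c' h h' => simp only [TensorProduct.tmul_add, TensorProduct.add_tmul, map_add, h, h']
  | h_mul c c' h h' =>
    rw [braiding_mul_right, h, pushRight_tmul, h']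
    simp

/-- The homogeneous elements of degree `n` of the plane. -/
def homog (q : kˣ) (n : ℕ) : Submodule k (Plane q) :=
  Submodule.span k (mono q '' {i | i.1 + i.2 = n})

theorem mono_mem_homog (q : kˣ) (i : ℕ × ℕ) : mono q i ∈ homog q (i.1 + i.2) :=
  Submodule.subset_span ⟨i, rfl, rfl⟩

theorem homog_mul (q : kˣ) {m n : ℕ} {a b : Plane q} (ha : a ∈ homog q m) (hb : b ∈ homog q n) :
    a * b ∈ homog q (m + n) := by
  have h := Submodule.mul_mem_mul ha hb
  rw [homog, homog, Submodule.span_mul_span] at h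
  refine Submodule.span_le.2 ?_ h
  rintro _ ⟨_, ⟨i, hi, rfl⟩, _, ⟨j, hj, rfl⟩, rfl⟩
  simp only [mono_mul]
  refine Submodule.smul_mem _ _ (Submodule.subset_span ⟨_, ?_, rfl⟩)
  simp only [Set.mem_ofPred_eq, Prod.fst_add, Prod.snd_add] at *
  omega

theorem coord_mem_homog (q : kˣ) (i : Fin 2) : coord q i ∈ homog q 1 := by
  fin_cases i
  · simpa [← coord_zero_eq] using mono_mem_homog q (1, 0)
  · simpa [← coord_one_eq] using mono_mem_homog q (0, 1)

theorem one_mem_homog (q : kˣ) : (1 : Plane q) ∈ homog q 0 := by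
  simpa [mono_zero] using mono_mem_homog q (0, 0)

/-- Induction over monomials as words in the coordinates. -/
theorem mono_induction (q : kˣ) {P : ℕ → Plane q → Prop} (h1 : P 0 1)
    (hc : ∀ n i a, P n a → P (n + 1) (coord q i * a)) (i : ℕ × ℕ) :
    P (i.1 + i.2) (mono q i) := by
  obtain ⟨m, n⟩ := i
  simp only [mono]
  induction m with
  | zero =>
    induction n with
    | zero => simpa using h1
    | succ n ih => simpa [pow_succ', ← add_assoc] using hc _ 1 _ ih
  | succ m ih =>
    have := hc _ 0 _ ih
    rw [← mul_assoc, ← pow_succ'] at this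
    convert this using 1
    omega

theorem braidOp_homog (q : kˣ) (j i : Fin 2) {n : ℕ} {a : Plane q} (ha : a ∈ homog q n) :
    braidOp q j i a ∈ homog q n := by
  have key : ∀ I : ℕ × ℕ, ∀ j i, braidOp q j i (mono q I) ∈ homog q (I.1 + I.2) := by
    intro I
    refine mono_induction q (P := fun n a => ∀ j i, braidOp q j i a ∈ homog q n) ?_ ?_ I
    · intro j i
      rw [braidOp_one]
      split_ifs
      · exact one_mem_homog q
      · exact Submodule.zero_mem _
    · intro n l a h j i
      have hl : ∀ j i, braidOp q j i (coord q l) ∈ homog q 1 := by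
        intro j i
        have h0 := coord_mem_homog q 0
        have h1 := coord_mem_homog q 1
        fin_cases l <;> fin_cases j <;> fin_cases i <;>
          simp [braidOp, braidGen_x, braidGen_y, Submodule.smul_mem, h0, h1]
      rw [braidOp_mul, add_comm n 1]
      exact Submodule.add_mem _ (homog_mul q (hl _ _) (h _ _)) (homog_mul q (hl _ _) (h _ _))
  induction ha using Submodule.span_induction with
  | mem x hx =>
    obtain ⟨I, hI, rfl⟩ := hx
    exact hI ▸ key I j i
  | zero => simp
  | add x y _ _ hx hy => rw [map_add]; exact Submodule.add_mem _ hx hy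
  | smul c x _ hx => rw [map_smul]; exact Submodule.smul_mem _ _ hx

theorem braiding_homog (q : kˣ) (J : ℕ × ℕ) {m : ℕ} {a : Plane q} (ha : a ∈ homog q m) :
    braiding q (a ⊗ₜ[k] mono q J) ∈
      Submodule.map₂ (TensorProduct.mk k _ _) (homog q (J.1 + J.2)) (homog q m) := by
  refine mono_induction q (P := fun n b => ∀ a ∈ homog q m, braiding q (a ⊗ₜ[k] b) ∈
      Submodule.map₂ (TensorProduct.mk k _ _) (homog q n) (homog q m)) ?_ ?_ J a ha
  · intro a ha
    rw [braiding_one_right]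
    exact Submodule.apply_mem_map₂ _ (one_mem_homog q) ha
  · intro n i b hb a ha
    rw [braiding_mul_right, braiding_coord, map_sum]
    refine Submodule.sum_mem _ fun j _ => ?_
    rw [pushRight_tmul]
    have := Submodule.mem_map_of_mem (f := (LinearMap.mulLeft k (coord q j)).rTensor (Plane q))
      (hb _ (braidOp_homog q j i ha))
    refine (Submodule.map_le_iff_le_comap.2 (Submodule.map₂_le.2 ?_)) this
    intro u hu v hv
    rw [Submodule.mem_comap, TensorProduct.mk_apply, LinearMap.rTensor_tmul,
      LinearMap.mulLeft_apply, add_comm n 1]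
    exact Submodule.apply_mem_map₂ _ (homog_mul q (coord_mem_homog q j) hu) hv

/-- The entries `R^a_i^b_j` of the matrix of the braiding in the basis of monomials:
`Ψ (e_i ⊗ e_j) = ∑ a b, R^a_i^b_j • e_b ⊗ e_a`. -/
noncomputable def braidMat (q : kˣ) (a i b j : ℕ × ℕ) : k :=
  ((planeBasis q).tensorProduct (planeBasis q)).repr (braiding q (mono q i ⊗ₜ[k] mono q j)) (b, a)

/-- `Ψ` preserves the degrees of both factors, so for given `i`, `j` (or given `a`, `b`) the only
entries `R^a_i^b_j` that may be nonzero have `|a| = |i|` and `|b| = |j|`. -/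
theorem braidMat_eq_zero (q : kˣ) {a i b j : ℕ × ℕ}
    (h : a.1 + a.2 ≠ i.1 + i.2 ∨ b.1 + b.2 ≠ j.1 + j.2) : braidMat q a i b j = 0 := by
  have hc : ∀ (I : ℕ × ℕ) (n : ℕ), ∀ u ∈ homog q n, I.1 + I.2 ≠ n → (planeBasis q).repr u I = 0 := by
    intro I n u hu hI
    induction hu using Submodule.span_induction with
    | mem x hx =>
      obtain ⟨J, hJ, rfl⟩ := hx
      rw [← planeBasis_apply, Module.Basis.repr_self, Finsupp.single_apply, if_neg]
      rintro rfl
      exact hI hJ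
    | zero => simp
    | add x y _ _ hx hy => simp [hx, hy]
    | smul c x _ hx => simp [hx]
  have hm := braiding_homog q j (mono_mem_homog q i)
  have hle : Submodule.map₂ (TensorProduct.mk k _ _) (homog q (j.1 + j.2)) (homog q (i.1 + i.2)) ≤
      LinearMap.ker (Finsupp.lapply (b, a) ∘ₗ
        ((planeBasis q).tensorProduct (planeBasis q)).repr.toLinearMap) := by
    refine Submodule.map₂_le.2 fun u hu v hv => ?_
    rw [LinearMap.mem_ker]
    simp only [LinearMap.comp_apply, LinearEquiv.coe_coe, TensorProduct.mk_apply,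
      Finsupp.lapply_apply, Module.Basis.tensorProduct_repr_tmul_apply]
    rcases h with h | h
    · rw [hc _ _ v hv h, zero_smul]
    · rw [hc _ _ u hu h, smul_zero]
  exact LinearMap.mem_ker.1 (hle hm)

/-- The total degree of a pair of exponents. -/
def deg (i : ℕ × ℕ) : ℕ := i.1 + i.2

/-- The finite set of the pairs of exponents of total degree `n`. -/
def ofDeg (n : ℕ) : Finset (ℕ × ℕ) := Finset.HasAntidiagonal.antidiagonal n

/-- The finite set of the pairs of exponents of total degree at most `n`. -/
def upTo (n : ℕ) : Finset (ℕ × ℕ) := (Finset.Iic (n, n)).filter fun i => deg i ≤ n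

/-- The finite set of the pairs `(u, v)` of pairs of exponents with `u + v = m`. -/
def splits (m : ℕ × ℕ) : Finset ((ℕ × ℕ) × (ℕ × ℕ)) :=
  (Finset.Iic m ×ˢ Finset.Iic m).filter fun p => p.1 + p.2 = m

theorem mem_ofDeg {n : ℕ} {i : ℕ × ℕ} : i ∈ ofDeg n ↔ deg i = n := by
  simp [ofDeg, deg]

theorem mem_upTo {n : ℕ} {i : ℕ × ℕ} : i ∈ upTo n ↔ deg i ≤ n := by
  rw [upTo, Finset.mem_filter, Finset.mem_Iic, Prod.le_def, and_iff_right_iff_imp]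
  intro h
  simp only [deg] at *
  omega

theorem mem_splits {m : ℕ × ℕ} {p : (ℕ × ℕ) × (ℕ × ℕ)} : p ∈ splits m ↔ p.1 + p.2 = m := by
  simp only [splits, Finset.mem_filter, Finset.mem_product, Finset.mem_Iic, and_iff_right_iff_imp]
  rintro rfl
  exact ⟨le_self_add, le_add_self⟩

/-- The free generator `t^i_j`. -/
noncomputable def freeT (k : Type*) [Field k] (i j : ℕ × ℕ) : FreeAlgebra k ((ℕ × ℕ) × (ℕ × ℕ)) :=
  FreeAlgebra.ι k (i, j)

/-- The relations of the restricted dual-quasitriangular comeasuring bialgebra of the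
quantum-braided plane, for the generators `t^i_j` indexed by the basis `e_i` of monomials:
* `comeas`: `∑ c_{a b}^m t^a_i t^b_j = ∑ c_{i j}^a t^m_a`, where the structure constants are
  `c_{(i,j)(k,l)}^{(m,n)} = δ^m_{i+k} δ^n_{j+l} q ^ (j k)`;
* `rtt`: `∑ R^i_a^j_b t^a_k t^b_l = ∑ t^j_b t^i_a R^a_k^b_l`, where only the indices `a`, `b` with
  `|a| = |i|`, `|b| = |j|` on the left, and `|a| = |k|`, `|b| = |l|` on the right, contribute, as
  the other entries of `R` vanish;
* the coaction `e_i ↦ ∑ e_a ⊗ t^a_i` respects `e_0 = 1` (`unit`, `col`) and the splitting of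
  the plane into the multiples of `1` and the span of the other monomials (`row`). -/
inductive ComeasRel (q : kˣ) :
    FreeAlgebra k ((ℕ × ℕ) × (ℕ × ℕ)) → FreeAlgebra k ((ℕ × ℕ) × (ℕ × ℕ)) → Prop
  | comeas (m i j : ℕ × ℕ) : ComeasRel q
      (∑ p ∈ splits m, (q : k) ^ (p.1.2 * p.2.1) • (freeT k p.1 i * freeT k p.2 j))
      ((q : k) ^ (i.2 * j.1) • freeT k m (i + j))
  | rtt (i j m n : ℕ × ℕ) : ComeasRel q
      (∑ a ∈ ofDeg (deg i), ∑ b ∈ ofDeg (deg j),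
        braidMat q i a j b • (freeT k a m * freeT k b n))
      (∑ a ∈ ofDeg (deg m), ∑ b ∈ ofDeg (deg n),
        braidMat q a m b n • (freeT k j b * freeT k i a))
  | unit : ComeasRel q (freeT k 0 0) 1
  | col (i : ℕ × ℕ) (hi : i ≠ 0) : ComeasRel q (freeT k i 0) 0
  | row (i : ℕ × ℕ) (hi : i ≠ 0) : ComeasRel q (freeT k 0 i) 0

/-- The algebra `M₀(R, A)` for the quantum-braided plane `A`. -/
abbrev Comeas (q : kˣ) : Type _ := RingQuot (ComeasRel q)

/-- The generator `t^i_j` of `M₀(R, A)`. -/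
noncomputable def tGen (q : kˣ) (i j : ℕ × ℕ) : Comeas q :=
  RingQuot.mkAlgHom k (ComeasRel q) (freeT k i j)

theorem tGen_comeas (q : kˣ) (m i j : ℕ × ℕ) :
    ∑ p ∈ splits m, (q : k) ^ (p.1.2 * p.2.1) • (tGen q p.1 i * tGen q p.2 j) =
      (q : k) ^ (i.2 * j.1) • tGen q m (i + j) := by
  simpa [tGen, map_sum] using RingQuot.mkAlgHom_rel k (ComeasRel.comeas (q := q) m i j)

theorem tGen_rtt (q : kˣ) (i j m n : ℕ × ℕ) :
    ∑ a ∈ ofDeg (deg i), ∑ b ∈ ofDeg (deg j), braidMat q i a j b • (tGen q a m * tGen q b n) =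
      ∑ a ∈ ofDeg (deg m), ∑ b ∈ ofDeg (deg n), braidMat q a m b n • (tGen q j b * tGen q i a) := by
  simpa [tGen, map_sum] using RingQuot.mkAlgHom_rel k (ComeasRel.rtt (q := q) i j m n)

theorem tGen_unit (q : kˣ) : tGen q 0 0 = 1 := by
  simpa [tGen] using RingQuot.mkAlgHom_rel k (ComeasRel.unit (q := q))

theorem tGen_col (q : kˣ) {i : ℕ × ℕ} (hi : i ≠ 0) : tGen q i 0 = 0 := by
  simpa [tGen] using RingQuot.mkAlgHom_rel k (ComeasRel.col (q := q) i hi)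

theorem tGen_row (q : kˣ) {i : ℕ × ℕ} (hi : i ≠ 0) : tGen q 0 i = 0 := by
  simpa [tGen] using RingQuot.mkAlgHom_rel k (ComeasRel.row (q := q) i hi)

/-- `t^m_j = 0` unless `|j| ≤ |m|`. -/
theorem tGen_eq_zero (q : kˣ) {m j : ℕ × ℕ} (h : deg m < deg j) : tGen q m j = 0 := by
  induction hn : deg m using Nat.strong_induction_on generalizing m j with
  | _ n ih =>
  have hj : j ≠ 0 := by
    rintro rfl
    simp [deg] at h
  by_cases hm : m = 0
  · rw [hm]
    exact tGen_row q hj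
  · obtain ⟨i, j', rfl, hi⟩ : ∃ i j', j = i + j' ∧ deg i = 1 := by
      by_cases h1 : j.1 = 0
      · refine ⟨(0, 1), (j.1, j.2 - 1), ?_, rfl⟩
        ext <;> simp
        simp [deg] at h
        omega
      · refine ⟨(1, 0), (j.1 - 1, j.2), ?_, rfl⟩
        ext <;> simp
        omega
    have hs := tGen_comeas q m i j'
    have hq : (q : k) ^ (i.2 * j'.1) ≠ 0 := pow_ne_zero _ q.ne_zero
    rw [Finset.sum_eq_zero] at hs
    · exact ((smul_eq_zero.1 hs.symm).resolve_left hq)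
    · rintro ⟨u, v⟩ hp
      rw [mem_splits] at hp
      simp only at hp ⊢
      have hd : deg (i + j') = deg i + deg j' := by simp [deg]; omega
      have hd' : deg u + deg v = deg m := by rw [← hp]; simp [deg]; omega
      by_cases hu : u = 0
      · rw [hu, tGen_row q (i := i) (by rintro rfl; simp [deg] at hi), zero_mul, smul_zero]
      · have : deg u ≠ 0 := by
          intro h0
          apply hu
          simp only [deg] at h0
          ext <;> simp <;> omega
        rw [ih (deg v) (by omega) (by omega) rfl, mul_zero, smul_zero]

/-- The universal property of `M₀(R, A)`. -/
noncomputable def comeasLift (q : kˣ) {B : Type*} [Ring B] [Algebra k B] (f : ℕ × ℕ → ℕ × ℕ → B)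
    (h_comeas : ∀ m i j, ∑ p ∈ splits m, (q : k) ^ (p.1.2 * p.2.1) • (f p.1 i * f p.2 j) =
      (q : k) ^ (i.2 * j.1) • f m (i + j))
    (h_rtt : ∀ i j m n,
      ∑ a ∈ ofDeg (deg i), ∑ b ∈ ofDeg (deg j), braidMat q i a j b • (f a m * f b n) =
        ∑ a ∈ ofDeg (deg m), ∑ b ∈ ofDeg (deg n), braidMat q a m b n • (f j b * f i a))
    (h_unit : f 0 0 = 1) (h_col : ∀ i, i ≠ 0 → f i 0 = 0) (h_row : ∀ i, i ≠ 0 → f 0 i = 0) :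
    Comeas q →ₐ[k] B :=
  RingQuot.liftAlgHom k ⟨FreeAlgebra.lift k fun p => f p.1 p.2, by
    rintro _ _ (⟨m, i, j⟩ | ⟨i, j, m, n⟩ | _ | ⟨i, hi⟩ | ⟨i, hi⟩)
    · simpa [freeT, map_sum] using h_comeas m i j
    · simpa [freeT, map_sum] using h_rtt i j m n
    · simpa [freeT] using h_unit
    · simpa [freeT] using h_col i hi
    · simpa [freeT] using h_row i hi⟩

@[simp] theorem comeasLift_tGen (q : kˣ) {B : Type*} [Ring B] [Algebra k B]
    (f : ℕ × ℕ → ℕ × ℕ → B) (h₁ h₂ h₃ h₄ h₅) (i j : ℕ × ℕ) :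
    comeasLift q f h₁ h₂ h₃ h₄ h₅ (tGen q i j) = f i j := by
  simp [comeasLift, tGen, freeT, RingQuot.liftAlgHom_mkAlgHom_apply]

theorem comeas_hom_ext (q : kˣ) {B : Type*} [Semiring B] [Algebra k B] {f g : Comeas q →ₐ[k] B}
    (h : ∀ i j, f (tGen q i j) = g (tGen q i j)) : f = g := by
  refine RingQuot.ringQuot_ext' k f g (FreeAlgebra.hom_ext (funext fun p => ?_))
  exact h p.1 p.2

theorem sum_comm_four {M I : Type*} [AddCommMonoid M] (s t u v : Finset I) (f : I → I → I → I → M) :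
    ∑ a ∈ s, ∑ b ∈ t, ∑ c ∈ u, ∑ d ∈ v, f a b c d =
      ∑ c ∈ u, ∑ d ∈ v, ∑ a ∈ s, ∑ b ∈ t, f a b c d := by
  calc _ = ∑ a ∈ s, ∑ c ∈ u, ∑ b ∈ t, ∑ d ∈ v, f a b c d :=
        Finset.sum_congr rfl fun _ _ => Finset.sum_comm
    _ = ∑ c ∈ u, ∑ a ∈ s, ∑ d ∈ v, ∑ b ∈ t, f a b c d := by
        rw [Finset.sum_comm]
        exact Finset.sum_congr rfl fun _ _ => Finset.sum_congr rfl fun _ _ => Finset.sum_comm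
    _ = _ := Finset.sum_congr rfl fun _ _ => Finset.sum_comm

/-- The coproduct `Δ t^i_j = ∑ a, t^i_a ⊗ t^a_j`, a finite sum as `t^i_a = 0` for `|i| < |a|`. -/
noncomputable def comeasComul (q : kˣ) : Comeas q →ₐ[k] Comeas q ⊗[k] Comeas q :=
  comeasLift q (fun i j => ∑ a ∈ upTo (deg i), tGen q i a ⊗ₜ[k] tGen q a j)
    (by
      intro m i j
      have ext_up : ∀ (u j : ℕ × ℕ) (N : ℕ), deg u ≤ N →
          ∑ a ∈ upTo (deg u), tGen q u a ⊗ₜ[k] tGen q a j =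
            ∑ a ∈ upTo N, tGen q u a ⊗ₜ[k] tGen q a j := by
        intro u j N hu
        refine Finset.sum_subset (fun a ha => ?_) (fun a _ ha => ?_)
        · rw [mem_upTo] at *
          omega
        · rw [mem_upTo, not_le] at ha
          rw [tGen_eq_zero q ha, TensorProduct.zero_tmul]
      have hdeg : ∀ p ∈ splits m, deg p.1 ≤ deg m ∧ deg p.2 ≤ deg m := by
        intro p hp
        rw [mem_splits] at hp
        rw [← hp]
        simp only [deg, Prod.fst_add, Prod.snd_add]
        omega
      calc _ = ∑ p ∈ splits m, ∑ u ∈ upTo (deg m), ∑ v ∈ upTo (deg m),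
            ((q : k) ^ (p.1.2 * p.2.1) • (tGen q p.1 u * tGen q p.2 v)) ⊗ₜ[k]
              (tGen q u i * tGen q v j) := by
            refine Finset.sum_congr rfl fun p hp => ?_
            rw [ext_up _ _ _ (hdeg p hp).1, ext_up _ _ _ (hdeg p hp).2, Finset.sum_mul_sum,
              Finset.smul_sum]
            refine Finset.sum_congr rfl fun u _ => ?_
            rw [Finset.smul_sum]
            refine Finset.sum_congr rfl fun v _ => ?_
            rw [Algebra.TensorProduct.tmul_mul_tmul, TensorProduct.smul_tmul']
        _ = ∑ u ∈ upTo (deg m), ∑ v ∈ upTo (deg m),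
            tGen q m (u + v) ⊗ₜ[k]
              ((q : k) ^ (u.2 * v.1) • (tGen q u i * tGen q v j)) := by
            rw [Finset.sum_comm]
            refine Finset.sum_congr rfl fun u _ => ?_
            rw [Finset.sum_comm]
            refine Finset.sum_congr rfl fun v _ => ?_
            rw [← TensorProduct.sum_tmul, tGen_comeas, TensorProduct.smul_tmul]
        _ = ∑ w ∈ upTo (deg m), ∑ p ∈ splits w,
            tGen q m (p.1 + p.2) ⊗ₜ[k]
              ((q : k) ^ (p.1.2 * p.2.1) • (tGen q p.1 i * tGen q p.2 j)) := by
            rw [← Finset.sum_product', Finset.sum_sigma']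
            symm
            refine Finset.sum_of_injOn (fun x => x.2) ?_ ?_ ?_ ?_
            · rintro ⟨w, p⟩ hx ⟨w', p'⟩ hx' hpp
              simp only [Finset.coe_sigma, Set.mem_sigma_iff, Finset.mem_coe, mem_splits] at *
              subst hpp
              rw [← hx.2, ← hx'.2]
            · rintro ⟨w, p⟩ hx
              simp only [Finset.coe_sigma, Set.mem_sigma_iff, Finset.mem_coe, mem_splits, mem_upTo,
                Finset.mem_product] at *
              obtain ⟨hx, rfl⟩ := hx
              simp only [deg, Prod.fst_add, Prod.snd_add] at *
              omega
            · rintro p hp hn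
              rw [tGen_eq_zero, TensorProduct.zero_tmul]
              by_contra hlt
              apply hn
              refine ⟨⟨p.1 + p.2, p⟩, ?_, rfl⟩
              simp only [Finset.coe_sigma, Set.mem_sigma_iff, Finset.mem_coe, mem_splits, mem_upTo,
                and_true]
              omega
            · intros
              rfl
        _ = _ := by
            rw [Finset.smul_sum]
            refine Finset.sum_congr rfl fun w _ => ?_
            rw [← TensorProduct.tmul_smul, ← tGen_comeas, TensorProduct.tmul_sum]
            refine Finset.sum_congr rfl fun p hp => ?_
            rw [mem_splits.1 hp])
    (by
      intro i j m n
      calc _ = ∑ u ∈ upTo (deg i), ∑ v ∈ upTo (deg j),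
            (∑ a ∈ ofDeg (deg i), ∑ b ∈ ofDeg (deg j),
              braidMat q i a j b • (tGen q a u * tGen q b v)) ⊗ₜ[k]
                (tGen q u m * tGen q v n) := by
            simp only [TensorProduct.sum_tmul]
            rw [← sum_comm_four]
            refine Finset.sum_congr rfl fun a ha => Finset.sum_congr rfl fun b hb => ?_
            rw [mem_ofDeg.1 ha, mem_ofDeg.1 hb, Finset.sum_mul_sum, Finset.smul_sum]
            refine Finset.sum_congr rfl fun u _ => ?_
            rw [Finset.smul_sum]
            refine Finset.sum_congr rfl fun v _ => ?_
            rw [Algebra.TensorProduct.tmul_mul_tmul, TensorProduct.smul_tmul']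
        _ = ∑ u ∈ upTo (deg i), ∑ v ∈ upTo (deg j),
            ∑ a ∈ ofDeg (deg u), ∑ b ∈ ofDeg (deg v),
              (tGen q j b * tGen q i a) ⊗ₜ[k]
                (braidMat q a u b v • (tGen q u m * tGen q v n)) := by
            refine Finset.sum_congr rfl fun u _ => Finset.sum_congr rfl fun v _ => ?_
            rw [tGen_rtt]
            simp only [TensorProduct.sum_tmul, TensorProduct.smul_tmul]
        _ = ∑ a ∈ upTo (deg i), ∑ b ∈ upTo (deg j), ∑ u ∈ ofDeg (deg a), ∑ v ∈ ofDeg (deg b),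
              (tGen q j b * tGen q i a) ⊗ₜ[k]
                (braidMat q a u b v • (tGen q u m * tGen q v n)) := by
            have hsw : ∀ u ∈ upTo (deg i), ∑ v ∈ upTo (deg j), ∑ a ∈ ofDeg (deg u),
                ∑ b ∈ ofDeg (deg v), (tGen q j b * tGen q i a) ⊗ₜ[k]
                  (braidMat q a u b v • (tGen q u m * tGen q v n)) =
                ∑ a ∈ ofDeg (deg u), ∑ v ∈ upTo (deg j),
                ∑ b ∈ ofDeg (deg v), (tGen q j b * tGen q i a) ⊗ₜ[k]
                  (braidMat q a u b v • (tGen q u m * tGen q v n)) :=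
              fun u _ => Finset.sum_comm
            rw [Finset.sum_congr rfl hsw]
            rw [Finset.sum_comm' (t' := upTo (deg i)) (s' := fun a => ofDeg (deg a))
              (by intros; simp only [mem_upTo, mem_ofDeg]; constructor <;> rintro ⟨h, h'⟩ <;>
                    constructor <;> omega)]
            refine Finset.sum_congr rfl fun a _ => ?_
            rw [Finset.sum_comm (s := upTo (deg j)) (t := ofDeg (deg a))]
            refine Finset.sum_congr rfl fun u _ => ?_
            rw [Finset.sum_comm' (t' := upTo (deg j)) (s' := fun b => ofDeg (deg b))
              (by intros; simp only [mem_upTo, mem_ofDeg]; constructor <;> rintro ⟨h, h'⟩ <;>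
                    constructor <;> omega)]
        _ = ∑ a ∈ upTo (deg i), ∑ b ∈ upTo (deg j), ∑ u ∈ ofDeg (deg m), ∑ v ∈ ofDeg (deg n),
              (tGen q j b * tGen q i a) ⊗ₜ[k]
                (braidMat q u m v n • (tGen q b v * tGen q a u)) := by
            refine Finset.sum_congr rfl fun a _ => Finset.sum_congr rfl fun b _ => ?_
            simp only [← TensorProduct.tmul_sum]
            rw [tGen_rtt]
        _ = _ := by
            rw [sum_comm_four]
            refine Finset.sum_congr rfl fun u _ => Finset.sum_congr rfl fun v _ => ?_
            rw [Finset.sum_comm, Finset.sum_mul_sum, Finset.smul_sum]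
            refine Finset.sum_congr rfl fun b _ => ?_
            rw [Finset.smul_sum]
            refine Finset.sum_congr rfl fun a _ => ?_
            rw [Algebra.TensorProduct.tmul_mul_tmul, TensorProduct.tmul_smul])
    (by
      rw [Finset.sum_eq_single 0]
      · rw [tGen_unit]
        rfl
      · intro a _ ha
        rw [tGen_row q ha, TensorProduct.zero_tmul]
      · intro h
        exact absurd (mem_upTo.2 le_rfl) h)
    (by
      intro i hi
      refine Finset.sum_eq_zero fun a _ => ?_
      by_cases ha : a = 0
      · rw [ha, tGen_col q hi, TensorProduct.zero_tmul]
      · rw [tGen_col q ha, TensorProduct.tmul_zero])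
    (by
      intro i hi
      refine Finset.sum_eq_zero fun a _ => ?_
      by_cases ha : a = 0
      · rw [ha, tGen_row q hi, TensorProduct.tmul_zero]
      · rw [tGen_row q ha, TensorProduct.zero_tmul])

/-- The counit `ε (t^i_j) = δ^i_j`. -/
noncomputable def comeasCounit (q : kˣ) : Comeas q →ₐ[k] k :=
  comeasLift q (fun i j => if i = j then 1 else 0)
    (by
      intro m i j
      by_cases h : m = i + j
      · rw [Finset.sum_eq_single (i, j)]
        · simp [h]
        · rintro ⟨u, v⟩ _ hn
          have : ¬ (u = i ∧ v = j) := by simpa using hn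
          by_cases hu : u = i
          · have hv : v ≠ j := fun hv => this ⟨hu, hv⟩
            simp [hv]
          · simp [hu]
        · intro hn
          exact absurd (mem_splits.2 h.symm) hn
      · rw [if_neg h, smul_zero]
        refine Finset.sum_eq_zero ?_
        rintro ⟨u, v⟩ hp
        rw [mem_splits] at hp
        by_cases hu : u = i
        · have hv : v ≠ j := fun hv => h (by rw [← hp, hu, hv])
          simp [hv]
        · simp [hu])
    (by
      intro i j m n
      have hL : ∀ a b : ℕ × ℕ, braidMat q i a j b •
          ((if a = m then (1 : k) else 0) * (if b = n then 1 else 0)) =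
          if a = m then (if b = n then braidMat q i a j b else 0) else 0 := by
        intro a b
        split_ifs <;> simp
      have hR : ∀ a b : ℕ × ℕ, braidMat q a m b n •
          ((if j = b then (1 : k) else 0) * (if i = a then 1 else 0)) =
          if i = a then (if j = b then braidMat q a m b n else 0) else 0 := by
        intro a b
        split_ifs <;> simp
      simp only [hL, hR]
      simp only [Finset.sum_ite_irrel, Finset.sum_const_zero, Finset.sum_ite_eq,
        Finset.sum_ite_eq', mem_ofDeg]
      simp only [eq_comm])
    (by simp) (by intro i hi; simp [hi]) (by intro i hi; simp [hi.symm])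

/-- The bialgebra structure of `M₀(R, A)`. -/
noncomputable instance comeasBialgebra (q : kˣ) : Bialgebra k (Comeas q) :=
  Bialgebra.ofAlgHom (comeasComul q) (comeasCounit q)
    (by
      refine comeas_hom_ext q fun i j => ?_
      simp only [comeasComul, AlgHom.comp_apply, comeasLift_tGen, map_sum,
        Algebra.TensorProduct.map_tmul, AlgHom.id_apply, TensorProduct.sum_tmul,
        TensorProduct.tmul_sum]
      rw [Finset.sum_comm]
      refine Finset.sum_congr rfl fun b hb => ?_
      symm
      refine Finset.sum_subset (fun a ha => ?_) (fun a _ ha => ?_)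
      · rw [mem_upTo] at *
        omega
      · rw [mem_upTo, not_le] at ha
        simp [tGen_eq_zero q ha])
    (by
      refine comeas_hom_ext q fun i j => ?_
      simp only [comeasComul, comeasCounit, AlgHom.comp_apply, comeasLift_tGen, map_sum,
        Algebra.TensorProduct.map_tmul, AlgHom.id_apply]
      rw [Finset.sum_eq_single i]
      · simp
      · intro a _ ha
        simp [ha.symm]
      · intro hi
        exact absurd (mem_upTo.2 le_rfl) hi)
    (by
      refine comeas_hom_ext q fun i j => ?_
      simp only [comeasComul, comeasCounit, AlgHom.comp_apply, comeasLift_tGen, map_sum,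
        Algebra.TensorProduct.map_tmul, AlgHom.id_apply]
      rw [Finset.sum_eq_single j]
      · simp
      · intro a _ ha
        simp [ha]
      · intro hj
        rw [mem_upTo, not_le] at hj
        simp [tGen_eq_zero q hj])

theorem comul_tGen (q : kˣ) (i j : ℕ × ℕ) : Coalgebra.comul (R := k) (tGen q i j) =
    ∑ a ∈ upTo (deg i), tGen q i a ⊗ₜ[k] tGen q a j :=
  comeasLift_tGen q _ _ _ _ _ _ i j

theorem counit_tGen (q : kˣ) (i j : ℕ × ℕ) :
    Coalgebra.counit (R := k) (tGen q i j) = if i = j then 1 else 0 :=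
  comeasLift_tGen q _ _ _ _ _ _ i j

/-- The relations of `M_q(2)` for the matrix of generators `a b; c d`, where
`a`, `b`, `c`, `d` are the free generators `(0, 0)`, `(0, 1)`, `(1, 0)`, `(1, 1)`. -/
inductive MatRel (q : kˣ) : FreeAlgebra k (Fin 2 × Fin 2) → FreeAlgebra k (Fin 2 × Fin 2) → Prop
  | ba : MatRel q (FreeAlgebra.ι k (0, 1) * FreeAlgebra.ι k (0, 0))
      ((q : k) • (FreeAlgebra.ι k (0, 0) * FreeAlgebra.ι k (0, 1)))
  | ca : MatRel q (FreeAlgebra.ι k (1, 0) * FreeAlgebra.ι k (0, 0))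
      ((q : k) • (FreeAlgebra.ι k (0, 0) * FreeAlgebra.ι k (1, 0)))
  | db : MatRel q (FreeAlgebra.ι k (1, 1) * FreeAlgebra.ι k (0, 1))
      ((q : k) • (FreeAlgebra.ι k (0, 1) * FreeAlgebra.ι k (1, 1)))
  | dc : MatRel q (FreeAlgebra.ι k (1, 1) * FreeAlgebra.ι k (1, 0))
      ((q : k) • (FreeAlgebra.ι k (1, 0) * FreeAlgebra.ι k (1, 1)))
  | cb : MatRel q (FreeAlgebra.ι k (1, 0) * FreeAlgebra.ι k (0, 1))
      (FreeAlgebra.ι k (0, 1) * FreeAlgebra.ι k (1, 0))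
  | da : MatRel q
      (FreeAlgebra.ι k (1, 1) * FreeAlgebra.ι k (0, 0) -
        FreeAlgebra.ι k (0, 0) * FreeAlgebra.ι k (1, 1))
      (((q : k) - (q : k)⁻¹) • (FreeAlgebra.ι k (0, 1) * FreeAlgebra.ι k (1, 0)))

/-- The algebra `M_q(2)` of `2 × 2` quantum matrices. -/
abbrev QMat (q : kˣ) : Type _ := RingQuot (MatRel q)

/-- The matrix of generators of `M_q(2)`. -/
noncomputable def mGen (q : kˣ) (i j : Fin 2) : QMat q :=
  RingQuot.mkAlgHom k (MatRel q) (FreeAlgebra.ι k (i, j))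

/-- The defining relations of `M_q(2)` for a matrix of elements of an algebra. -/
def IsQMat (q : kˣ) {B : Type*} [Ring B] [Algebra k B] (m : Fin 2 → Fin 2 → B) : Prop :=
  m 0 1 * m 0 0 = (q : k) • (m 0 0 * m 0 1) ∧ m 1 0 * m 0 0 = (q : k) • (m 0 0 * m 1 0) ∧
  m 1 1 * m 0 1 = (q : k) • (m 0 1 * m 1 1) ∧ m 1 1 * m 1 0 = (q : k) • (m 1 0 * m 1 1) ∧
  m 1 0 * m 0 1 = m 0 1 * m 1 0 ∧
  m 1 1 * m 0 0 - m 0 0 * m 1 1 = ((q : k) - (q : k)⁻¹) • (m 0 1 * m 1 0)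

theorem mGen_isQMat (q : kˣ) : IsQMat q (mGen q) := by
  refine ⟨?_, ?_, ?_, ?_, ?_, ?_⟩
  · simpa [mGen] using RingQuot.mkAlgHom_rel k (MatRel.ba (q := q))
  · simpa [mGen] using RingQuot.mkAlgHom_rel k (MatRel.ca (q := q))
  · simpa [mGen] using RingQuot.mkAlgHom_rel k (MatRel.db (q := q))
  · simpa [mGen] using RingQuot.mkAlgHom_rel k (MatRel.dc (q := q))
  · simpa [mGen] using RingQuot.mkAlgHom_rel k (MatRel.cb (q := q))
  · simpa [mGen] using RingQuot.mkAlgHom_rel k (MatRel.da (q := q))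

/-- The universal property of `M_q(2)`. -/
noncomputable def qmatLift (q : kˣ) {B : Type*} [Ring B] [Algebra k B] (m : Fin 2 → Fin 2 → B)
    (h : IsQMat q m) : QMat q →ₐ[k] B :=
  RingQuot.liftAlgHom k ⟨FreeAlgebra.lift k fun p => m p.1 p.2, by
    obtain ⟨h₁, h₂, h₃, h₄, h₅, h₆⟩ := h
    rintro _ _ (_ | _ | _ | _ | _ | _)
    · simpa using h₁
    · simpa using h₂
    · simpa using h₃
    · simpa using h₄
    · simpa using h₅
    · simpa using h₆⟩

@[simp] theorem qmatLift_mGen (q : kˣ) {B : Type*} [Ring B] [Algebra k B]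
    (m : Fin 2 → Fin 2 → B) (h : IsQMat q m) (i j : Fin 2) :
    qmatLift q m h (mGen q i j) = m i j := by
  simp [qmatLift, mGen, RingQuot.liftAlgHom_mkAlgHom_apply]

theorem qmat_hom_ext (q : kˣ) {B : Type*} [Semiring B] [Algebra k B] {f g : QMat q →ₐ[k] B}
    (h : ∀ i j, f (mGen q i j) = g (mGen q i j)) : f = g := by
  refine RingQuot.ringQuot_ext' k f g (FreeAlgebra.hom_ext (funext fun p => ?_))
  exact h p.1 p.2

/-- The matrix coproduct `Δ m^i_j = ∑ a, m^i_a ⊗ m^a_j`. -/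
noncomputable def qmatComul (q : kˣ) : QMat q →ₐ[k] QMat q ⊗[k] QMat q :=
  qmatLift q (fun i j => ∑ a, mGen q i a ⊗ₜ[k] mGen q a j) (by
    obtain ⟨h₁, h₂, h₃, h₄, h₅, h₆⟩ := mGen_isQMat q
    have h₇ := sub_eq_iff_eq_add.1 h₆
    have hq : (q : k) ≠ 0 := q.ne_zero
    refine ⟨?_, ?_, ?_, ?_, ?_, sub_eq_iff_eq_add.2 ?_⟩ <;>
    · simp only [Fin.sum_univ_two, mul_add, add_mul, Algebra.TensorProduct.tmul_mul_tmul,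
        h₁, h₂, h₃, h₄, h₅, h₇, TensorProduct.add_tmul, TensorProduct.tmul_add,
        TensorProduct.tmul_smul, ← TensorProduct.smul_tmul']
      match_scalars <;> field_simp <;> ring)

/-- The counit `ε (m^i_j) = δ^i_j`. -/
noncomputable def qmatCounit (q : kˣ) : QMat q →ₐ[k] k :=
  qmatLift q (fun i j => if i = j then 1 else 0) (by simp [IsQMat])

theorem qmatCounit_mGen (q : kˣ) (i j : Fin 2) :
    qmatCounit q (mGen q i j) = if i = j then 1 else 0 :=
  qmatLift_mGen q _ _ i j

/-- The bialgebra structure of `M_q(2)`. -/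
noncomputable instance qmatBialgebra (q : kˣ) : Bialgebra k (QMat q) :=
  Bialgebra.ofAlgHom (qmatComul q) (qmatCounit q)
    (by
      refine qmat_hom_ext q fun i j => ?_
      simp only [qmatComul, AlgHom.comp_apply, qmatLift_mGen, map_sum,
        Algebra.TensorProduct.map_tmul, AlgHom.id_apply, TensorProduct.sum_tmul,
        TensorProduct.tmul_sum]
      rw [Finset.sum_comm]
      rfl)
    (by
      refine qmat_hom_ext q fun i j => ?_
      simp only [qmatComul, AlgHom.comp_apply, qmatLift_mGen, map_sum, qmatCounit_mGen,
        Algebra.TensorProduct.map_tmul, AlgHom.id_apply]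
      fin_cases i <;> simp)
    (by
      refine qmat_hom_ext q fun i j => ?_
      simp only [qmatComul, AlgHom.comp_apply, qmatLift_mGen, map_sum, qmatCounit_mGen,
        Algebra.TensorProduct.map_tmul, AlgHom.id_apply]
      fin_cases j <;> simp)

theorem comul_mGen (q : kˣ) (i j : Fin 2) : Coalgebra.comul (R := k) (mGen q i j) =
    ∑ a, mGen q i a ⊗ₜ[k] mGen q a j :=
  qmatLift_mGen q _ _ i j

theorem counit_mGen (q : kˣ) (i j : Fin 2) :
    Coalgebra.counit (R := k) (mGen q i j) = if i = j then 1 else 0 :=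
  qmatLift_mGen q _ _ i j

/-- The standard R-matrix `R^i_j^k_l` of `su_2` type, in the normalization of the
quantum-braided plane. -/
def suMat (q : kˣ) (i j l m : Fin 2) : k :=
  if i = j ∧ l = m then (if i = l then (q : k) ^ 2 else (q : k))
  else if i = 0 ∧ j = 1 ∧ l = 1 ∧ m = 0 then (q : k) ^ 2 - 1 else 0

/-- A dual quasitriangular structure on a bialgebra `H`: a convolution-invertible bilinear
form `𝓡` such that, in Sweedler notation,
* `𝓡(ab, c) = 𝓡(a, c₁) 𝓡(b, c₂)`,
* `𝓡(a, bc) = 𝓡(a₁, c) 𝓡(a₂, b)`,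
* `b₁ a₁ 𝓡(a₂, b₂) = 𝓡(a₁, b₁) a₂ b₂`.
Convolution is that of the coalgebra `H ⊗ H`, whose coproduct is
`a ⊗ b ↦ (a₁ ⊗ b₁) ⊗ (a₂ ⊗ b₂)`. -/
structure IsDualQuasitriangular {H : Type*} [Ring H] [Bialgebra k H]
    (R : H →ₗ[k] H →ₗ[k] k) : Prop where
  mul_left : ∀ a b c, R (a * b) c =
    LinearMap.mul' k k (TensorProduct.map (R a) (R b) (Coalgebra.comul (R := k) c))
  mul_right : ∀ a b c, R a (b * c) =
    LinearMap.mul' k k (TensorProduct.map (R.flip c) (R.flip b) (Coalgebra.comul (R := k) a))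
  comm : ∀ a b,
    TensorProduct.rid k H (TensorProduct.map
        (LinearMap.mul' k H ∘ₗ (TensorProduct.comm k H H).toLinearMap) (TensorProduct.lift R)
        (Coalgebra.comul (R := k) (a ⊗ₜ[k] b))) =
      TensorProduct.lid k H (TensorProduct.map (TensorProduct.lift R) (LinearMap.mul' k H)
        (Coalgebra.comul (R := k) (a ⊗ₜ[k] b)))
  invertible : ∃ S : H ⊗[k] H →ₗ[k] k, ∀ x : H ⊗[k] H,
    LinearMap.mul' k k (TensorProduct.map (TensorProduct.lift R) S
        (Coalgebra.comul (R := k) x)) = Coalgebra.counit (R := k) x ∧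
    LinearMap.mul' k k (TensorProduct.map S (TensorProduct.lift R)
        (Coalgebra.comul (R := k) x)) = Coalgebra.counit (R := k) x

/-- The exponents `(1, 0)` and `(0, 1)` of the coordinates `x` and `y`. -/
def low : Fin 2 → ℕ × ℕ := ![(1, 0), (0, 1)]

end
end QuantumPlane

/-! The quantum plane is a comodule algebra of $M_q(2)$ by $x_j\mapsto\sum_i x_i\otimes m^i{}_j$,
and $\Psi$ is the braiding that a dual quasitriangular form $\mathcal R_2$ of $M_q(2)$ induces on
this comodule. Everything follows from these two facts.

The form. The relations of $M_q(2)$ are equivalent to $Rt_1t_2=t_2t_1R$ for $R=R_{su_2}$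
(`IsQMat.isRTT`, `IsRTT.isQMat`). Fixing the first argument to be a generator gives functionals
`suFun`, the entries of a matrix representation; by the Yang–Baxter equation they satisfy the same
relations in the convolution algebra of functionals (`suFun_isRTT`), so they extend to an algebra
map from $M_q(2)$ to that algebra, which is $\mathcal R_2$ (`qmatForm`). The remaining axioms hold
on generators and pass to products. The inverse comes from the form for $q^{-1}$, flipped and with
the indices reversed.

The maps. Let $T^I{}_J\in M_q(2)$ be the matrix coefficients of the coaction on monomials
(`coactionMat`); they vanish unless $|I|=|J|$. Comparing the two algebra maps that encode $\Psi$ and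
the coaction on $x$ and $y$ gives $R^I{}_J{}^K{}_L=\mathcal R_2(T^I{}_J,T^K{}_L)$ (`braidMat_eq`).
Thus $t^I{}_J\mapsto T^I{}_J$ respects all relations of $M_0$: the comeasuring ones because the
coaction is multiplicative, the $R$-relations because $\mathcal R_2$ satisfies the commutation
axiom. This is $p$. Conversely the degree-one $R$-relations of $M_0$ are those of $M_q(2)$, which
gives $\iota$ (`tGen_low_isQMat`). On generators $p\circ\iota=\mathrm{id}$, so $p$ is onto and
$\iota$ is injective.

The extension. Put $\mathcal R=\mathcal R_2\circ(p\otimes p)$. Multiplicativity in each argument and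
invertibility pull back along $p$. The commutation axiom does not, being an identity in $M_0$
itself; on generators it is the defining $R$-relation, and `commAt_mul_left` and
`IsComatrix.commAt_mul_right` carry it to products (`comeasForm_commAt`). -/

namespace QuantumPlane

/-! ### Convolution products and their closure properties. -/

section Sweedler
variable {k H C : Type*} [Field k] [Ring H] [Bialgebra k H] [Ring C] [Algebra k C]

/-- The convolution product `a ↦ f a₁ * g a₂`. -/
noncomputable def conv (f g : H →ₗ[k] C) : H →ₗ[k] C :=
  LinearMap.mul' k C ∘ₗ TensorProduct.map f g ∘ₗ Coalgebra.comul

theorem conv_apply_repr (f g : H →ₗ[k] C) {a : H} {ι : Type*} (r : Coalgebra.Repr k a ι) :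
    conv f g a = ∑ i ∈ r.index, f (r.left i) * g (r.right i) := by
  simp [conv, ← r.eq]

theorem conv_mul_repr (f g : H →ₗ[k] C) {a b : H} {ι κ : Type*} (r : Coalgebra.Repr k a ι)
    (s : Coalgebra.Repr k b κ) : conv f g (a * b) = ∑ i ∈ r.index, ∑ j ∈ s.index,
      f (r.left i * s.left j) * g (r.right i * s.right j) := by
  simp [conv, ← r.eq, ← s.eq, Finset.sum_mul_sum]

/-- A comultiplicative family `Δ T_ij = ∑ a, T_ia ⊗ T_aj` of elements, indexed by a finite set. -/
def IsComatrix {ι : Type*} (s : Finset ι) (T : ι → ι → H) : Prop :=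
  ∀ i ∈ s, ∀ j ∈ s, Coalgebra.comul (R := k) (T i j) = ∑ a ∈ s, T i a ⊗ₜ[k] T a j

theorem IsComatrix.conv_apply {ι : Type*} {s : Finset ι} {T : ι → ι → H}
    (hT : IsComatrix (k := k) s T) (f g : H →ₗ[k] C) {i j : ι} (hi : i ∈ s) (hj : j ∈ s) :
    conv f g (T i j) = ∑ a ∈ s, f (T i a) * g (T a j) := by
  simp [conv, hT i hi j hj]

/-- The set where an algebra map and an antimultiplicative map are convolution inverse is closed
under multiplication. -/
theorem conv_mul_of_hom_antihom {f g : H →ₗ[k] C} (hf : ∀ a b, f (a * b) = f a * f b)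
    (hg : ∀ a b, g (a * b) = g b * g a) {a b : H}
    (ha : conv f g a = algebraMap k C (Coalgebra.counit a))
    (hb : conv f g b = algebraMap k C (Coalgebra.counit b)) :
    conv f g (a * b) = algebraMap k C (Coalgebra.counit (a * b)) := by
  have r := Coalgebra.Repr.arbitrary k a
  have s := Coalgebra.Repr.arbitrary k b
  rw [conv_apply_repr f g r] at ha
  rw [conv_apply_repr f g s] at hb
  rw [conv_mul_repr f g r s, Bialgebra.counit_mul, map_mul, ← ha, Finset.sum_mul]
  refine Finset.sum_congr rfl fun i _ => ?_
  rw [mul_assoc, ← Algebra.commutes, ← hb, Finset.sum_mul, Finset.mul_sum]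
  refine Finset.sum_congr rfl fun j _ => ?_
  simp only [hf, hg, mul_assoc]

/-- The set where an antimultiplicative map and an algebra map are convolution inverse is closed
under multiplication. -/
theorem conv_mul_of_antihom_hom {f g : H →ₗ[k] C} (hf : ∀ a b, f (a * b) = f b * f a)
    (hg : ∀ a b, g (a * b) = g a * g b) {a b : H}
    (ha : conv f g a = algebraMap k C (Coalgebra.counit a))
    (hb : conv f g b = algebraMap k C (Coalgebra.counit b)) :
    conv f g (a * b) = algebraMap k C (Coalgebra.counit (a * b)) := by
  have r := Coalgebra.Repr.arbitrary k a
  have s := Coalgebra.Repr.arbitrary k b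
  rw [conv_apply_repr f g r] at ha
  rw [conv_apply_repr f g s] at hb
  rw [conv_mul_repr f g r s, Bialgebra.counit_mul, map_mul, Algebra.commutes, ← hb,
    Finset.sum_mul, Finset.sum_comm]
  refine Finset.sum_congr rfl fun j _ => ?_
  rw [mul_assoc, ← Algebra.commutes, ← ha, Finset.sum_mul, Finset.mul_sum]
  refine Finset.sum_congr rfl fun i _ => ?_
  simp only [hf, hg, mul_assoc]

end Sweedler

/-! ### Extending the commutation axiom from generators to products. -/

section Forms
variable {k H : Type*} [Field k] [Ring H] [Bialgebra k H]

/-- `R(a b, c) = R(a, c₁) R(b, c₂)`. -/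
def MulLeft (R : H →ₗ[k] H →ₗ[k] k) : Prop := ∀ a b c, R (a * b) c = conv (R a) (R b) c

/-- `R(a, b c) = R(a₁, c) R(a₂, b)`. -/
def MulRight (R : H →ₗ[k] H →ₗ[k] k) : Prop := ∀ a b c, R a (b * c) = conv (R.flip c) (R.flip b) a

/-- `b₁ a₁ R(a₂, b₂) = R(a₁, b₁) a₂ b₂`, written as an equality of sums of convolution products. -/
def CommAt (R : H →ₗ[k] H →ₗ[k] k) (a b : H) : Prop :=
  TensorProduct.rid k H (TensorProduct.map
      (LinearMap.mul' k H ∘ₗ (TensorProduct.comm k H H).toLinearMap) (TensorProduct.lift R)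
      (Coalgebra.comul (R := k) (a ⊗ₜ[k] b))) =
    TensorProduct.lid k H (TensorProduct.map (TensorProduct.lift R) (LinearMap.mul' k H)
      (Coalgebra.comul (R := k) (a ⊗ₜ[k] b)))

theorem commAt_iff_repr {R : H →ₗ[k] H →ₗ[k] k} {a b : H} {ι κ : Type*}
    (r : Coalgebra.Repr k a ι) (s : Coalgebra.Repr k b κ) :
    CommAt R a b ↔ ∑ i ∈ r.index, ∑ j ∈ s.index,
        R (r.right i) (s.right j) • (s.left j * r.left i) =
      ∑ i ∈ r.index, ∑ j ∈ s.index, R (r.left i) (s.left j) • (r.right i * s.right j) := by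
  simp only [CommAt, TensorProduct.comul_tmul, ← r.eq, ← s.eq, TensorProduct.sum_tmul,
    TensorProduct.tmul_sum, map_sum, TensorProduct.AlgebraTensorModule.tensorTensorTensorComm_tmul,
    TensorProduct.map_tmul, LinearMap.comp_apply, LinearEquiv.coe_coe, TensorProduct.comm_tmul,
    LinearMap.mul'_apply, TensorProduct.lift.tmul, TensorProduct.rid_tmul, TensorProduct.lid_tmul]
  rw [Finset.sum_comm, Finset.sum_comm (s := s.index)]

/-- The representation of `Δ (a b)` as the product of representations of `Δ a` and `Δ b`. -/
def reprMul {a b : H} {ι κ : Type*} (r : Coalgebra.Repr k a ι) (s : Coalgebra.Repr k b κ) :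
    Coalgebra.Repr k (a * b) (ι × κ) where
  index := r.index ×ˢ s.index
  left p := r.left p.1 * s.left p.2
  right p := r.right p.1 * s.right p.2
  eq := by
    rw [Bialgebra.comul_mul, ← r.eq, ← s.eq, Finset.sum_mul_sum, Finset.sum_product]
    simp

-- In the convolution algebra of linear maps $H\to H$ put $X=\mathrm{id}$, $c_a(b)=\varepsilon(b)a$
-- and $\rho_a(b)=\mathcal R(a,b)1$. The axiom for $a$ and all $b$ reads $X\,L(a)=M(a)\,X$ with
-- $L(a)=c_{a_1}\rho_{a_2}$ and $M(a)=\rho_{a_1}c_{a_2}$. Since $c$ and $\rho$ are multiplicative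
-- and commute with each other, $L$ and $M$ are multiplicative, and such an intertwining relation is
-- stable under products.
open WithConv in
theorem commAt_mul_left {R : H →ₗ[k] H →ₗ[k] k} (hR : MulLeft R) {a a' : H}
    (ha : ∀ b, CommAt R a b) (ha' : ∀ b, CommAt R a' b) (b : H) : CommAt R (a * a') b := by
  let X : WithConv (H →ₗ[k] H) := toConv LinearMap.id
  let c : H → WithConv (H →ₗ[k] H) := fun a =>
    toConv (LinearMap.toSpanSingleton k H a ∘ₗ Coalgebra.counit)
  let ρ : H → WithConv (H →ₗ[k] H) := fun a => toConv (Algebra.linearMap k H ∘ₗ R a)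
  have hcf : ∀ x (f : WithConv (H →ₗ[k] H)) b, (c x * f) b = x * f b := by
    intro x f b
    conv_rhs => rw [← Coalgebra.sum_counit_smul (Coalgebra.Repr.arbitrary k b)]
    rw [(Coalgebra.Repr.arbitrary k b).convMul_apply]
    simp [c, Finset.mul_sum]
  have hfc : ∀ x (f : WithConv (H →ₗ[k] H)) b, (f * c x) b = f b * x := by
    intro x f b
    have h1 : (f * c 1) b = f b := by
      have : c 1 = 1 := by
        refine WithConv.ext (LinearMap.ext fun h => ?_)
        simp [c, Algebra.algebraMap_eq_smul_one]
      rw [this, mul_one]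
    rw [← h1, (Coalgebra.Repr.arbitrary k b).convMul_apply,
      (Coalgebra.Repr.arbitrary k b).convMul_apply]
    simp [c, Finset.sum_mul]
  have hc : ∀ x y, c (x * y) = c x * c y := by
    intro x y
    refine WithConv.ext (LinearMap.ext fun h => ?_)
    rw [hcf]
    simp [c]
  have hρ : ∀ x y, ρ (x * y) = ρ x * ρ y := by
    intro x y
    refine WithConv.ext (LinearMap.ext fun h => ?_)
    rw [(Coalgebra.Repr.arbitrary k h).convMul_apply]
    simp [ρ, hR x y h, conv_apply_repr _ _ (Coalgebra.Repr.arbitrary k h)]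
  have hcρ : ∀ x y, c x * ρ y = ρ y * c x := by
    intro x y
    refine WithConv.ext (LinearMap.ext fun h => ?_)
    rw [hcf, hfc]
    exact (Algebra.commutes _ _).symm
  -- The intertwining form $X\,L(a)=M(a)\,X$ of the axiom, for any representation of $\Delta a$.
  have key : ∀ {a : H} {ι : Type _} (r : Coalgebra.Repr k a ι), (∀ b, CommAt R a b) ↔
      ∑ i ∈ r.index, X * (c (r.left i) * ρ (r.right i)) =
        ∑ i ∈ r.index, ρ (r.left i) * c (r.right i) * X := by
    intro a ι r
    rw [← ofConv_injective.eq_iff, LinearMap.ext_iff]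
    refine forall_congr' fun b => ?_
    rw [commAt_iff_repr r (Coalgebra.Repr.arbitrary k b)]
    simp only [ofConv_sum, LinearMap.sum_apply]
    have h1 : ∀ x y, (X * (c x * ρ y)) b = ∑ j ∈ (Coalgebra.Repr.arbitrary k b).index,
        R y ((Coalgebra.Repr.arbitrary k b).right j) •
          ((Coalgebra.Repr.arbitrary k b).left j * x) := by
      intro x y
      rw [← mul_assoc, (Coalgebra.Repr.arbitrary k b).convMul_apply]
      refine Finset.sum_congr rfl fun j _ => ?_
      rw [hfc]
      simp [X, ρ, Algebra.algebraMap_eq_smul_one]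
    have h2 : ∀ x y, (ρ x * c y * X) b = ∑ j ∈ (Coalgebra.Repr.arbitrary k b).index,
        R x ((Coalgebra.Repr.arbitrary k b).left j) •
          (y * (Coalgebra.Repr.arbitrary k b).right j) := by
      intro x y
      rw [mul_assoc, (Coalgebra.Repr.arbitrary k b).convMul_apply]
      refine Finset.sum_congr rfl fun j _ => ?_
      rw [hcf]
      simp [X, ρ, Algebra.algebraMap_eq_smul_one]
    simp only [h1, h2]
  have r := Coalgebra.Repr.arbitrary k a
  have r' := Coalgebra.Repr.arbitrary k a'
  refine (key (reprMul r r')).2 ?_ b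
  have h := (key r).1 ha
  have h' := (key r').1 ha'
  simp only [← Finset.mul_sum, ← Finset.sum_mul] at h h'
  have e1 : ∑ i ∈ (reprMul r r').index, X * (c ((reprMul r r').left i) * ρ ((reprMul r r').right i))
      = X * (∑ i ∈ r.index, c (r.left i) * ρ (r.right i)) *
        ∑ i ∈ r'.index, c (r'.left i) * ρ (r'.right i) := by
    rw [mul_assoc, Finset.sum_mul_sum, Finset.mul_sum]
    simp only [reprMul, hc, hρ, Finset.mul_sum, mul_assoc]
    rw [Finset.sum_product]
    refine Finset.sum_congr rfl fun i _ => ?_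
    refine Finset.sum_congr rfl fun j _ => ?_
    rw [← mul_assoc (c (r'.left j)), hcρ, mul_assoc]
  have e2 : ∑ i ∈ (reprMul r r').index, ρ ((reprMul r r').left i) * c ((reprMul r r').right i) * X
      = (∑ i ∈ r.index, ρ (r.left i) * c (r.right i)) *
        ((∑ i ∈ r'.index, ρ (r'.left i) * c (r'.right i)) * X) := by
    rw [← mul_assoc, Finset.sum_mul_sum, Finset.sum_mul]
    simp only [reprMul, hc, hρ, Finset.sum_mul, mul_assoc]
    rw [Finset.sum_product]
    refine Finset.sum_congr rfl fun i _ => ?_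
    refine Finset.sum_congr rfl fun j _ => ?_
    rw [← mul_assoc (ρ (r'.left j)), ← hcρ, mul_assoc]
  rw [e1, e2, h, mul_assoc, h']

theorem sum_comm_four' {M α β γ δ : Type*} [AddCommMonoid M] (s : Finset α) (t : Finset β)
    (u : Finset γ) (v : Finset δ) (f : α → β → γ → δ → M) :
    ∑ a ∈ s, ∑ b ∈ t, ∑ c ∈ u, ∑ d ∈ v, f a b c d =
      ∑ c ∈ u, ∑ d ∈ v, ∑ a ∈ s, ∑ b ∈ t, f a b c d := by
  simp only [← Finset.sum_product' (s := s), ← Finset.sum_product' (s := u)]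
  exact Finset.sum_comm

theorem IsComatrix.commAt_iff_repr {ι : Type*} {s : Finset ι} {T : ι → ι → H}
    (hT : IsComatrix (k := k) s T) (R : H →ₗ[k] H →ₗ[k] k) {i j : ι} (hi : i ∈ s) (hj : j ∈ s)
    {b : H} {κ : Type*} (r : Coalgebra.Repr k b κ) : CommAt R (T i j) b ↔
      ∑ a ∈ s, ∑ x ∈ r.index, R (T a j) (r.right x) • (r.left x * T i a) =
        ∑ a ∈ s, ∑ x ∈ r.index, R (T i a) (r.left x) • (T a j * r.right x) := by
  exact QuantumPlane.commAt_iff_repr ⟨s, fun a => T i a, fun a => T a j, (hT i hi j hj).symm⟩ r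

/-- The counterpart in the second argument. The Sweedler legs of `T i j` are other entries of `T`,
so the hypothesis has to cover the whole family. Right multiplicativity splits $\mathcal R(T,xy)$
with the factor $y$ first, so the entry of `T` is moved past `b'` and then past `b`. -/
theorem IsComatrix.commAt_mul_right {ι : Type*} {s : Finset ι} {T : ι → ι → H}
    (hT : IsComatrix (k := k) s T) {R : H →ₗ[k] H →ₗ[k] k} (hR : MulRight R) {b b' : H}
    (hb : ∀ i ∈ s, ∀ j ∈ s, CommAt R (T i j) b) (hb' : ∀ i ∈ s, ∀ j ∈ s, CommAt R (T i j) b') :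
    ∀ i ∈ s, ∀ j ∈ s, CommAt R (T i j) (b * b') := by
  intro i hi j hj
  have r := Coalgebra.Repr.arbitrary k b
  have r' := Coalgebra.Repr.arbitrary k b'
  have hR' : ∀ i ∈ s, ∀ j ∈ s, ∀ x y, R (T i j) (x * y) = ∑ a ∈ s, R (T i a) y * R (T a j) x := by
    intro i hi j hj x y
    rw [hR, hT.conv_apply _ _ hi hj]
    rfl
  rw [hT.commAt_iff_repr R hi hj (reprMul r r')]
  simp only [reprMul, Finset.sum_product]
  have h : ∀ c ∈ s, ∀ j ∈ s, _ := fun c hc j hj => (hT.commAt_iff_repr R hc hj r).1 (hb c hc j hj)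
  have h' : ∀ c ∈ s, ∀ j ∈ s, _ :=
    fun c hc j hj => (hT.commAt_iff_repr R hc hj r').1 (hb' c hc j hj)
  calc _ = ∑ c ∈ s, ∑ x ∈ r.index, R (T c j) (r.right x) • (r.left x *
        ∑ a ∈ s, ∑ y ∈ r'.index, R (T a c) (r'.right y) • (r'.left y * T i a)) := by
        calc _ = ∑ a ∈ s, ∑ x ∈ r.index, ∑ y ∈ r'.index, ∑ c ∈ s,
              (R (T a c) (r'.right y) * R (T c j) (r.right x)) •
                (r.left x * r'.left y * T i a) := by
              refine Finset.sum_congr rfl fun a ha => Finset.sum_congr rfl fun x _ =>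
                Finset.sum_congr rfl fun y _ => ?_
              rw [hR' a ha j hj, Finset.sum_smul]
          _ = ∑ c ∈ s, ∑ x ∈ r.index, ∑ a ∈ s, ∑ y ∈ r'.index,
              (R (T a c) (r'.right y) * R (T c j) (r.right x)) •
                (r.left x * r'.left y * T i a) := by
              rw [Finset.sum_comm]
              conv_rhs => rw [Finset.sum_comm]
              refine Finset.sum_congr rfl fun x _ => ?_
              rw [Finset.sum_comm' (t' := s) (s' := fun _ => s) (by simp)]
              refine Finset.sum_congr rfl fun a _ => ?_
              rw [Finset.sum_comm]
          _ = _ := by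
              simp only [Finset.mul_sum, Finset.smul_sum, mul_smul_comm, smul_smul, mul_assoc,
                mul_comm (R (T _ j) _)]
    _ = ∑ c ∈ s, ∑ x ∈ r.index, R (T c j) (r.right x) • (r.left x *
        ∑ a ∈ s, ∑ y ∈ r'.index, R (T i a) (r'.left y) • (T a c * r'.right y)) := by
        refine Finset.sum_congr rfl fun c hc => Finset.sum_congr rfl fun x _ => ?_
        rw [h' i hi c hc]
    _ = ∑ a ∈ s, ∑ y ∈ r'.index, R (T i a) (r'.left y) • ((∑ c ∈ s, ∑ x ∈ r.index,
        R (T c j) (r.right x) • (r.left x * T a c)) * r'.right y) := by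
        simp only [Finset.mul_sum, Finset.sum_mul, Finset.smul_sum, mul_smul_comm, smul_mul_assoc,
          smul_smul, mul_assoc]
        rw [sum_comm_four']
        simp only [mul_comm (R (T _ j) _)]
    _ = ∑ a ∈ s, ∑ y ∈ r'.index, R (T i a) (r'.left y) • ((∑ c ∈ s, ∑ x ∈ r.index,
        R (T a c) (r.left x) • (T c j * r.right x)) * r'.right y) := by
        refine Finset.sum_congr rfl fun a ha => Finset.sum_congr rfl fun x _ => ?_
        rw [h a ha j hj]
    _ = _ := by
        calc _ = ∑ c ∈ s, ∑ x ∈ r.index, ∑ a ∈ s, ∑ y ∈ r'.index,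
              (R (T i a) (r'.left y) * R (T a c) (r.left x)) •
                (T c j * r.right x * r'.right y) := by
              rw [sum_comm_four']
              simp only [Finset.sum_mul, Finset.smul_sum, smul_mul_assoc, smul_smul]
          _ = ∑ c ∈ s, ∑ x ∈ r.index, ∑ y ∈ r'.index, ∑ a ∈ s,
              (R (T i a) (r'.left y) * R (T a c) (r.left x)) •
                (T c j * r.right x * r'.right y) :=
              Finset.sum_congr rfl fun c _ => Finset.sum_congr rfl fun x _ => Finset.sum_comm
          _ = _ := by
              refine Finset.sum_congr rfl fun c hc => Finset.sum_congr rfl fun x _ =>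
                Finset.sum_congr rfl fun y _ => ?_
              rw [hR' i hi c hc, Finset.sum_smul, mul_assoc]

end Forms

/-! ### The dual quasitriangular form of $M_q(2)$: construction and axioms. -/

section
variable {k : Type*} [Field k]

theorem qmat_induction (q : kˣ) {P : QMat q → Prop}
    (h_scalar : ∀ c, P (algebraMap k _ c)) (h_gen : ∀ i j, P (mGen q i j))
    (h_mul : ∀ a b, P a → P b → P (a * b)) (h_add : ∀ a b, P a → P b → P (a + b))
    (a : QMat q) : P a := by
  obtain ⟨a, rfl⟩ := RingQuot.mkAlgHom_surjective k (MatRel q) a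
  induction a using FreeAlgebra.induction with
  | grade0 r => simpa using h_scalar r
  | grade1 i => exact h_gen i.1 i.2
  | mul a b ha hb => simpa using h_mul _ _ ha hb
  | add a b ha hb => simpa using h_add _ _ ha hb

theorem comeas_induction (q : kˣ) {P : Comeas q → Prop}
    (h_scalar : ∀ c, P (algebraMap k _ c)) (h_gen : ∀ i j, P (tGen q i j))
    (h_mul : ∀ a b, P a → P b → P (a * b)) (h_add : ∀ a b, P a → P b → P (a + b))
    (a : Comeas q) : P a := by
  obtain ⟨a, rfl⟩ := RingQuot.mkAlgHom_surjective k (ComeasRel q) a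
  induction a using FreeAlgebra.induction with
  | grade0 r => simpa using h_scalar r
  | grade1 i => exact h_gen i.1 i.2
  | mul a b ha hb => simpa using h_mul _ _ ha hb
  | add a b ha hb => simpa using h_add _ _ ha hb

/-- The relations `R t₁ t₂ = t₂ t₁ R` for a `2 × 2` matrix. -/
def IsRTT (q : kˣ) {B : Type*} [Ring B] [Algebra k B] (t : Fin 2 → Fin 2 → B) : Prop :=
  ∀ i j m n, ∑ a, ∑ b, suMat q i a j b • (t a m * t b n) =
    ∑ a, ∑ b, suMat q a m b n • (t j b * t i a)

theorem IsQMat.isRTT {q : kˣ} {B : Type*} [Ring B] [Algebra k B] {t : Fin 2 → Fin 2 → B}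
    (h : IsQMat q t) : IsRTT q t := by
  obtain ⟨h₁, h₂, h₃, h₄, h₅, h₆⟩ := h
  have h₇ := sub_eq_iff_eq_add.1 h₆
  have hq : (q : k) ≠ 0 := q.ne_zero
  intro i j m n
  fin_cases i <;> fin_cases j <;> fin_cases m <;> fin_cases n <;>
    simp [suMat, h₁, h₂, h₃, h₄, h₅, h₇] <;> match_scalars <;> field_simp <;> ring

/-- Six of the sixteen components suffice. Four of the resulting equations carry an extra factor
$q$, which is cancelled because $q\ne0$. -/
theorem IsRTT.isQMat {q : kˣ} {B : Type*} [Ring B] [Algebra k B] {t : Fin 2 → Fin 2 → B}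
    (h : IsRTT q t) : IsQMat q t := by
  have hq : (q : k) ≠ 0 := q.ne_zero
  have cancel : ∀ {x y : B}, (q : k) • x = (q : k) • y → x = y :=
    fun {x y} h => smul_right_injective _ hq h
  have h1 := h 0 0 0 1
  have h2 := h 0 1 0 0
  have h3 := h 0 1 1 1
  have h4 := h 1 1 0 1
  have h5 := h 0 1 1 0
  have h6 := h 0 1 0 1
  simp [suMat] at h1 h2 h3 h4 h5 h6
  refine ⟨cancel ?_, ?_, ?_, cancel ?_, cancel ?_, cancel ?_⟩
  · linear_combination (norm := module) -h1
  · linear_combination (norm := module) -h2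
  · linear_combination (norm := module) -h3
  · linear_combination (norm := module) -h4
  · linear_combination (norm := module) -h5
  -- In the component `h5` the two terms $(q^2-1)\,da$ cancel, which leaves $bc=cb$. This is needed
  -- because `h6` produces $q(da-ad)=(q^2-1)\,cb$, with $b$ and $c$ in the other order.
  · have h7 := cancel (show (q : k) • (t 0 1 * t 1 0) = (q : k) • (t 1 0 * t 0 1) by
      linear_combination (norm := module) h5)
    rw [← h7] at h6
    rw [smul_smul, mul_sub, mul_inv_cancel₀ hq]
    linear_combination (norm := module) -h6

/-- The bilinear form on the generators as a matrix-valued function of the second argument. -/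
noncomputable def suRep (q : kˣ) : QMat q →ₐ[k] (Matrix (Fin 2) (Fin 2) k)ᵐᵒᵖ :=
  -- The opposite algebra encodes the reversed order in $\mathcal R(a,bc)=\mathcal R(a_1,c)\mathcal
  -- R(a_2,b)$.
  qmatLift q (fun l m => MulOpposite.op (Matrix.of fun i j => suMat q i j l m)) (by
    have hq : (q : k) ≠ 0 := q.ne_zero
    refine ⟨?_, ?_, ?_, ?_, ?_, ?_⟩ <;> apply MulOpposite.unop_injective <;> ext i j <;>
      fin_cases i <;> fin_cases j <;> simp [suMat, Matrix.mul_apply] <;> field_simp <;> ring)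

theorem suRep_mGen (q : kˣ) (l m i j : Fin 2) :
    (suRep q (mGen q l m)).unop i j = suMat q i j l m :=
  congrArg (fun M : (Matrix (Fin 2) (Fin 2) k)ᵐᵒᵖ => M.unop i j) (qmatLift_mGen q _ _ l m)

open WithConv in
/-- The functional `R₂(m^i_j, -)` on `M_q(2)`. -/
noncomputable def suFun (q : kˣ) (i j : Fin 2) : WithConv (QMat q →ₗ[k] k) :=
  toConv
    { toFun := fun x => (suRep q x).unop i j
      map_add' := by simp
      map_smul' := by simp }

theorem suFun_apply (q : kˣ) (i j : Fin 2) (x : QMat q) :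
    suFun q i j x = (suRep q x).unop i j := rfl

theorem suFun_mGen (q : kˣ) (i j l m : Fin 2) : suFun q i j (mGen q l m) = suMat q i j l m :=
  suRep_mGen q l m i j

theorem suFun_algebraMap (q : kˣ) (i j : Fin 2) (c : k) :
    suFun q i j (algebraMap k _ c) = if i = j then c else 0 := by
  rw [suFun_apply, AlgHom.commutes]
  simp [MulOpposite.algebraMap_apply, Matrix.algebraMap_matrix_apply]

theorem suFun_mul (q : kˣ) (i j : Fin 2) (x y : QMat q) :
    suFun q i j (x * y) = ∑ a, suFun q i a y * suFun q a j x := by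
  simp only [suFun_apply, map_mul, MulOpposite.unop_mul, Matrix.mul_apply]

/-- The Yang–Baxter equation for the matrix `suMat`. -/
theorem suMat_yangBaxter (q : kˣ) (u v i j m n : Fin 2) :
    ∑ a, ∑ b, suMat q i a j b * ∑ w, suMat q a m u w * suMat q b n w v =
      ∑ a, ∑ b, suMat q a m b n * ∑ w, suMat q j b u w * suMat q i a w v := by
  revert u v i j m n
  simp only [Fin.forall_fin_two, Fin.sum_univ_two, suMat]
  simp
  repeat' apply And.intro
  all_goals ring

/-- On a generator the relation is the Yang–Baxter equation. The convolution products `N` of two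
functionals form a matrix on the tensor square with $N(xy)=N(y)N(x)$, so the relation, which says
that $R$ intertwines `N` with its reordering, passes from $x$ and $y$ to $xy$. -/
theorem suFun_isRTT (q : kˣ) : IsRTT q (suFun q) := by
  let N : (i j l m : Fin 2) → QMat q → k := fun i j l m x => (suFun q i j * suFun q l m) x
  have hN : ∀ i j l m (x : QMat q) {ι : Type _} (r : Coalgebra.Repr k x ι), N i j l m x =
      ∑ s ∈ r.index, suFun q i j (r.left s) * suFun q l m (r.right s) :=
    fun i j l m x ι r => r.convMul_apply _ _
  have hmul : ∀ i j l m x y, N i j l m (x * y) = ∑ a, ∑ b, N i a l b y * N a j b m x := by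
    intro i j l m x y
    have r := Coalgebra.Repr.arbitrary k x
    have s := Coalgebra.Repr.arbitrary k y
    simp only [hN _ _ _ _ _ (reprMul r s), hN _ _ _ _ _ r, hN _ _ _ _ _ s, reprMul, suFun_mul,
      Finset.sum_mul_sum]
    rw [Finset.sum_product]
    dsimp only
    rw [sum_comm_four']
    refine Finset.sum_congr rfl fun a _ => Finset.sum_congr rfl fun b _ => ?_
    rw [Finset.sum_comm, Finset.sum_mul_sum]
    refine Finset.sum_congr rfl fun s _ => Finset.sum_congr rfl fun t _ => ?_
    ring
  have key : ∀ x : QMat q, ∀ i j m n, ∑ a, ∑ b, suMat q i a j b * N a m b n x =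
      ∑ a, ∑ b, suMat q a m b n * N j b i a x := by
    intro x
    induction x using qmat_induction with
    | h_scalar c =>
      have h : ∀ i j l m, N i j l m (algebraMap k _ c) =
          (if i = j then 1 else 0) * (if l = m then c else 0) := by
        intro i j l m
        simp only [N, LinearMap.convMul_apply, Bialgebra.comul_algebraMap,
          Algebra.TensorProduct.algebraMap_apply, TensorProduct.map_tmul, LinearMap.mul'_apply,
          suFun_algebraMap]
        have := suFun_algebraMap q l m 1
        rw [map_one] at this
        rw [this]
        split_ifs <;> simp
      intro i j m n
      simp [h]
    | h_gen u v =>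
      have h : ∀ i j l m, N i j l m (mGen q u v) = ∑ w, suMat q i j u w * suMat q l m w v := by
        intro i j l m
        simp only [N, LinearMap.convMul_apply, comul_mGen, map_sum, TensorProduct.map_tmul,
          LinearMap.mul'_apply, suFun_mGen]
      simp only [h]
      exact suMat_yangBaxter q u v
    | h_add x y hx hy =>
      intro i j m n
      have hadd : ∀ i j l m, N i j l m (x + y) = N i j l m x + N i j l m y :=
        fun i j l m => map_add _ _ _
      simp only [hadd, mul_add, Finset.sum_add_distrib, hx, hy]
    | h_mul x y hx hy =>
      intro i j m n
      -- The matrix $R$ is moved past the factor evaluated at $y$, then past the one at $x$.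
      calc _ = ∑ c, ∑ d, (∑ a, ∑ b, suMat q i a j b * N a c b d y) * N c m d n x := by
            simp only [hmul, Finset.mul_sum, Finset.sum_mul]
            rw [sum_comm_four']
            simp only [mul_assoc]
        _ = ∑ c, ∑ d, ∑ a, ∑ b, suMat q a c b d * N j b i a y * N c m d n x := by
            simp only [hy, Finset.sum_mul]
        _ = ∑ a, ∑ b, N j b i a y * ∑ c, ∑ d, suMat q a c b d * N c m d n x := by
            rw [sum_comm_four']
            refine Finset.sum_congr rfl fun a _ => Finset.sum_congr rfl fun b _ => ?_
            simp only [Finset.mul_sum]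
            refine Finset.sum_congr rfl fun c _ => Finset.sum_congr rfl fun d _ => ?_
            ring
        _ = ∑ a, ∑ b, N j b i a y * ∑ c, ∑ d, suMat q c m d n * N b d a c x := by
            simp only [hx]
        _ = _ := by
            simp only [hmul, Finset.mul_sum]
            rw [sum_comm_four']
            refine Finset.sum_congr rfl fun c _ => Finset.sum_congr rfl fun d _ => ?_
            rw [Finset.sum_comm]
            refine Finset.sum_congr rfl fun a _ => Finset.sum_congr rfl fun b _ => ?_
            ring
  intro i j m n
  refine WithConv.ext (LinearMap.ext fun x => ?_)
  simpa only [WithConv.ofConv_sum, WithConv.ofConv_smul, LinearMap.sum_apply, LinearMap.smul_apply,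
    smul_eq_mul] using key x i j m n

theorem conv_algebraMap {H C : Type*} [Ring H] [Bialgebra k H] [Ring C] [Algebra k C]
    (f g : H →ₗ[k] C) (c : k) : conv f g (algebraMap k H c) = c • (f 1 * g 1) := by
  simp only [conv, Algebra.algebraMap_eq_smul_one, map_smul, LinearMap.comp_apply,
    Bialgebra.comul_one, Algebra.TensorProduct.one_def, TensorProduct.map_tmul,
    LinearMap.mul'_apply]

/-- The induction step for right multiplicativity. With left multiplicativity both sides become the
same quadruple sum over the legs of $a,a',b,c$, because the values lie in the commutative field $k$.
-/
theorem mulRight_mul {H : Type*} [Ring H] [Bialgebra k H] {R : H →ₗ[k] H →ₗ[k] k}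
    (hR : MulLeft R) {a a' b c : H} (ha : ∀ b c, R a (b * c) = conv (R.flip c) (R.flip b) a)
    (ha' : ∀ b c, R a' (b * c) = conv (R.flip c) (R.flip b) a') :
    R (a * a') (b * c) = conv (R.flip c) (R.flip b) (a * a') := by
  have r := Coalgebra.Repr.arbitrary k a
  have r' := Coalgebra.Repr.arbitrary k a'
  have s := Coalgebra.Repr.arbitrary k b
  have t := Coalgebra.Repr.arbitrary k c
  rw [hR, conv_mul_repr _ _ s t, conv_mul_repr _ _ r r']
  simp only [ha, ha', conv_apply_repr _ _ r, conv_apply_repr _ _ r', LinearMap.flip_apply, hR _ _ b,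
    hR _ _ c, conv_apply_repr _ _ s, conv_apply_repr _ _ t, Finset.sum_mul_sum]
  rw [sum_comm_four']
  refine Finset.sum_congr rfl fun i _ => Finset.sum_congr rfl fun j _ => ?_
  rw [Finset.sum_comm]
  refine Finset.sum_congr rfl fun s _ => Finset.sum_congr rfl fun t _ => ?_
  ring

/-- The dual quasitriangular structure of `M_q(2)` as an algebra map into the dual. -/
noncomputable def qmatToDual (q : kˣ) : QMat q →ₐ[k] WithConv (QMat q →ₗ[k] k) :=
  qmatLift q (suFun q) (suFun_isRTT q).isQMat

/-- The dual quasitriangular structure of `M_q(2)`. -/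
noncomputable def qmatForm (q : kˣ) : QMat q →ₗ[k] QMat q →ₗ[k] k :=
  (WithConv.linearEquiv k (QMat q →ₗ[k] k)).toLinearMap ∘ₗ (qmatToDual q).toLinearMap

theorem qmatForm_apply (q : kˣ) (a b : QMat q) : qmatForm q a b = qmatToDual q a b := rfl

theorem qmatForm_mGen_left (q : kˣ) (i j : Fin 2) (b : QMat q) :
    qmatForm q (mGen q i j) b = suFun q i j b := by
  rw [qmatForm_apply, qmatToDual, qmatLift_mGen]

theorem qmatForm_mGen (q : kˣ) (i j l m : Fin 2) :
    qmatForm q (mGen q i j) (mGen q l m) = suMat q i j l m := by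
  rw [qmatForm_mGen_left, suFun_mGen]

theorem qmatForm_one_left (q : kˣ) (b : QMat q) : qmatForm q 1 b = Coalgebra.counit b := by
  rw [qmatForm_apply, map_one]
  simp

theorem qmatForm_mulLeft (q : kˣ) : MulLeft (qmatForm q) := by
  intro a b c
  rw [qmatForm_apply, map_mul]
  rfl

theorem mGen_isComatrix (q : kˣ) : IsComatrix (k := k) Finset.univ (mGen q) :=
  fun i _ j _ => comul_mGen q i j

/-- For a generator as first argument this is the antimultiplicativity of the matrix representation
`suRep`; products are handled by `mulRight_mul`. -/
theorem qmatForm_mulRight (q : kˣ) : MulRight (qmatForm q) := by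
  intro a b c
  induction a using qmat_induction generalizing b c with
  | h_scalar r =>
    rw [conv_algebraMap, Algebra.algebraMap_eq_smul_one]
    simp [qmatForm_one_left, mul_comm]
  | h_gen i j =>
    rw [(mGen_isComatrix q).conv_apply _ _ (Finset.mem_univ i) (Finset.mem_univ j)]
    simp only [LinearMap.flip_apply, qmatForm_mGen_left, suFun_mul]
  | h_mul a a' ha ha' => exact mulRight_mul (qmatForm_mulLeft q) ha ha'
  | h_add a a' ha ha' => simp only [map_add, LinearMap.add_apply, ha, ha']

theorem qmatForm_one_right (q : kˣ) (a : QMat q) : qmatForm q a 1 = Coalgebra.counit a := by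
  induction a using qmat_induction with
  | h_scalar r =>
    rw [Algebra.algebraMap_eq_smul_one]
    simp [qmatForm_one_left]
  | h_gen i j =>
    rw [qmatForm_mGen_left, counit_mGen, ← map_one (algebraMap k (QMat q)), suFun_algebraMap]
  | h_mul a a' ha ha' =>
    rw [qmatForm_mulLeft, Bialgebra.counit_mul, ← ha, ← ha', ← map_one (algebraMap k _),
      conv_algebraMap]
    simp
  | h_add a a' ha ha' => simp only [map_add, LinearMap.add_apply, ha, ha']

theorem sum_counit_smul_left {H : Type*} [Ring H] [Bialgebra k H] {a : H} {ι : Type*}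
    (r : Coalgebra.Repr k a ι) :
    ∑ i ∈ r.index, Coalgebra.counit (R := k) (r.right i) • r.left i = a := by
  have h := congrArg (TensorProduct.rid k H) (Coalgebra.sum_tmul_counit_eq r)
  simpa only [map_sum, TensorProduct.rid_tmul, one_smul] using h

/-- The representation `Δ c = 1 ⊗ c` for a scalar `c`. -/
def reprAlgebraMap (H : Type*) [Ring H] [Bialgebra k H] (c : k) :
    Coalgebra.Repr k (algebraMap k H c) Unit where
  index := Finset.univ
  left _ := 1
  right _ := algebraMap k H c
  eq := by simp [Algebra.algebraMap_eq_smul_one, Algebra.TensorProduct.one_def]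

theorem commAt_algebraMap_left {H : Type*} [Ring H] [Bialgebra k H] {R : H →ₗ[k] H →ₗ[k] k}
    (hR : ∀ b, R 1 b = Coalgebra.counit b) (c : k) (b : H) : CommAt R (algebraMap k H c) b := by
  have s := Coalgebra.Repr.arbitrary k b
  rw [commAt_iff_repr (reprAlgebraMap H c) s]
  simp only [reprAlgebraMap, Algebra.algebraMap_eq_smul_one, map_smul, LinearMap.smul_apply, hR,
    Finset.univ_unique, Finset.sum_singleton, smul_assoc, ← Finset.smul_sum, mul_one,
    smul_mul_assoc, one_mul, sum_counit_smul_left, smul_comm _ c, Coalgebra.sum_counit_smul]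

theorem commAt_algebraMap_right {H : Type*} [Ring H] [Bialgebra k H] {R : H →ₗ[k] H →ₗ[k] k}
    (hR : ∀ a, R a 1 = Coalgebra.counit a) (c : k) (a : H) : CommAt R a (algebraMap k H c) := by
  have s := Coalgebra.Repr.arbitrary k a
  rw [commAt_iff_repr s (reprAlgebraMap H c)]
  simp only [reprAlgebraMap, Algebra.algebraMap_eq_smul_one, map_smul, hR,
    Finset.univ_unique, Finset.sum_singleton, smul_assoc, ← Finset.smul_sum, mul_one,
    mul_smul_comm, one_mul, sum_counit_smul_left, smul_comm _ c, Coalgebra.sum_counit_smul]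

theorem CommAt.add_left {H : Type*} [Ring H] [Bialgebra k H] {R : H →ₗ[k] H →ₗ[k] k}
    {a a' b : H} (h : CommAt R a b) (h' : CommAt R a' b) : CommAt R (a + a') b := by
  simp only [CommAt, TensorProduct.add_tmul, map_add] at h h' ⊢
  rw [h, h']

theorem CommAt.add_right {H : Type*} [Ring H] [Bialgebra k H] {R : H →ₗ[k] H →ₗ[k] k}
    {a b b' : H} (h : CommAt R a b) (h' : CommAt R a b') : CommAt R a (b + b') := by
  simp only [CommAt, TensorProduct.tmul_add, map_add] at h h' ⊢
  rw [h, h']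

/-- For two generators the axiom is $Rt_1t_2=t_2t_1R$, which holds in $M_q(2)$. -/
theorem qmatForm_commAt (q : kˣ) (a b : QMat q) : CommAt (qmatForm q) a b := by
  induction a using qmat_induction generalizing b with
  | h_scalar r => exact commAt_algebraMap_left (qmatForm_one_left q) r b
  | h_mul a a' ha ha' => exact commAt_mul_left (qmatForm_mulLeft q) ha ha' b
  | h_add a a' ha ha' => exact (ha b).add_left (ha' b)
  | h_gen i j =>
    -- The induction on `b` has to carry all entries of the generating matrix at once, as
    -- multiplying in the second argument mixes them.
    suffices ∀ i ∈ Finset.univ, ∀ j ∈ Finset.univ, CommAt (qmatForm q) (mGen q i j) b from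
      this i (Finset.mem_univ i) j (Finset.mem_univ j)
    induction b using qmat_induction with
    | h_scalar r => exact fun i _ j _ => commAt_algebraMap_right (qmatForm_one_right q) r _
    | h_mul b b' hb hb' =>
      exact (mGen_isComatrix q).commAt_mul_right (qmatForm_mulRight q) hb hb'
    | h_add b b' hb hb' => exact fun i hi j hj => (hb i hi j hj).add_right (hb' i hi j hj)
    | h_gen l m =>
      intro i hi j hj
      rw [(mGen_isComatrix q).commAt_iff_repr _ hi hj
        ⟨Finset.univ, fun a => mGen q l a, fun a => mGen q a m, (comul_mGen q l m).symm⟩]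
      simpa only [qmatForm_mGen] using ((mGen_isQMat q).isRTT i l j m).symm

/-! ### Convolution invertibility of the form of $M_q(2)$. -/

theorem conv_comp {H H' C : Type*} [Ring H] [Bialgebra k H] [Ring H'] [Bialgebra k H'] [Ring C]
    [Algebra k C] (f g : H' →ₗ[k] C) (φ : H →ₐc[k] H') (a : H) :
    conv f g (φ a) = conv (f ∘ₗ (φ : H →ₐ[k] H').toLinearMap)
      (g ∘ₗ (φ : H →ₐ[k] H').toLinearMap) a := by
  have r := Coalgebra.Repr.arbitrary k a
  rw [conv_apply_repr _ _ r, conv, LinearMap.comp_apply, LinearMap.comp_apply,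
    ← CoalgHomClass.map_comp_comul_apply, ← r.eq]
  simp

/-- Reversing the order of the indices turns quantum matrices for `q` into those for `q⁻¹`. -/
noncomputable def qmatRev (q : kˣ) : QMat q →ₐc[k] QMat q⁻¹ :=
  BialgHom.ofAlgHom (qmatLift q (fun i j => mGen q⁻¹ i.rev j.rev) (by
      obtain ⟨h₁, h₂, h₃, h₄, h₅, h₆⟩ := mGen_isQMat q⁻¹
      have h₇ := sub_eq_iff_eq_add.1 h₆
      have hq : (q : k) ≠ 0 := q.ne_zero
      -- Reversal exchanges $a$ with $d$ and $b$ with $c$. It turns the sides of the $q$-commutation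
      -- relations around and changes the sign of $da-ad$; both effects are undone by $q\mapsto
      -- q^{-1}$.
      refine ⟨?_, ?_, ?_, ?_, ?_, ?_⟩ <;> simp [h₁, h₂, h₃, h₄, h₅, h₇, smul_smul, hq]
      module))
    (qmat_hom_ext q fun i j => by
      simp only [AlgHom.comp_apply, qmatLift_mGen, Bialgebra.counitAlgHom_apply, counit_mGen,
        Fin.rev_inj])
    (qmat_hom_ext q fun i j => by
      simp only [AlgHom.comp_apply, qmatLift_mGen, Bialgebra.comulAlgHom_apply, comul_mGen,
        map_sum, Algebra.TensorProduct.map_tmul]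
      exact Equiv.sum_comp Fin.revPerm fun a => mGen q⁻¹ i.rev a ⊗ₜ[k] mGen q⁻¹ a j.rev)

theorem qmatRev_mGen (q : kˣ) (i j : Fin 2) : qmatRev q (mGen q i j) = mGen q⁻¹ i.rev j.rev :=
  qmatLift_mGen q _ _ i j

/-- The convolution inverse of `qmatForm`. -/
noncomputable def qmatInvForm (q : kˣ) : QMat q →ₗ[k] QMat q →ₗ[k] k :=
  ((qmatForm q⁻¹).compl₁₂ (qmatRev q : QMat q →ₐ[k] QMat q⁻¹).toLinearMap
    (qmatRev q : QMat q →ₐ[k] QMat q⁻¹).toLinearMap).flip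

theorem qmatInvForm_apply (q : kˣ) (a b : QMat q) :
    qmatInvForm q a b = qmatForm q⁻¹ (qmatRev q b) (qmatRev q a) := rfl

/-- A convolution inverse must be multiplicative in the opposite order. The flip in `qmatInvForm`
achieves this by trading the left and right multiplicativity of the form for $q^{-1}$. -/
theorem qmatInvForm_mul_left (q : kˣ) (a a' b : QMat q) :
    qmatInvForm q (a * a') b = conv (qmatInvForm q a') (qmatInvForm q a) b := by
  rw [qmatInvForm_apply, map_mul, qmatForm_mulRight, conv_comp]
  rfl

theorem qmatInvForm_mul_right (q : kˣ) (a b b' : QMat q) :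
    qmatInvForm q a (b * b') = conv ((qmatInvForm q).flip b) ((qmatInvForm q).flip b') a := by
  rw [qmatInvForm_apply, map_mul, qmatForm_mulLeft, conv_comp]
  rfl

theorem qmatInvForm_mGen (q : kˣ) (i j l m : Fin 2) :
    qmatInvForm q (mGen q i j) (mGen q l m) = suMat q⁻¹ l.rev m.rev i.rev j.rev := by
  rw [qmatInvForm_apply, qmatRev_mGen, qmatRev_mGen, qmatForm_mGen]

theorem qmatInvForm_one_left (q : kˣ) (b : QMat q) : qmatInvForm q 1 b = Coalgebra.counit b := by
  rw [qmatInvForm_apply, map_one, qmatForm_one_right]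
  exact CoalgHomClass.counit_comp_apply _ _

theorem qmatInvForm_one_right (q : kˣ) (b : QMat q) : qmatInvForm q b 1 = Coalgebra.counit b := by
  rw [qmatInvForm_apply, map_one, qmatForm_one_left]
  exact CoalgHomClass.counit_comp_apply _ _

/-- The matrix-valued function `b ↦ F(m^i_j, b)`. -/
noncomputable def formMatrix (q : kˣ) (F : QMat q →ₗ[k] QMat q →ₗ[k] k) :
    QMat q →ₗ[k] Matrix (Fin 2) (Fin 2) k where
  toFun b := Matrix.of fun i j => F (mGen q i j) b
  map_add' _ _ := by ext; simp
  map_smul' _ _ := by ext; simp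

/-- Links two convolutions: that of matrix-valued functions of $b$, and the pairing of bilinear
forms along the comatrix of generators. Through it a result by induction on the second argument can
start an induction on the first. -/
theorem conv_formMatrix (q : kˣ) (F G : QMat q →ₗ[k] QMat q →ₗ[k] k) (b : QMat q) (i j : Fin 2) :
    conv (formMatrix q F) (formMatrix q G) b i j =
      ∑ a, conv (F (mGen q i a)) (G (mGen q a j)) b := by
  simp only [conv_apply_repr _ _ (Coalgebra.Repr.arbitrary k b), Matrix.sum_apply, formMatrix,
    LinearMap.coe_mk, AddHom.coe_mk, Matrix.mul_apply, Matrix.of_apply]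
  exact Finset.sum_comm

/-- A bilinear form as a map into the convolution algebra of functionals. -/
noncomputable def toDual {H : Type*} [Ring H] [Bialgebra k H] (F : H →ₗ[k] H →ₗ[k] k) :
    H →ₗ[k] WithConv (H →ₗ[k] k) :=
  (WithConv.linearEquiv k (H →ₗ[k] k)).symm.toLinearMap ∘ₗ F

theorem formMatrix_qmatForm_mul (q : kˣ) (b b' : QMat q) : formMatrix q (qmatForm q) (b * b') =
    formMatrix q (qmatForm q) b' * formMatrix q (qmatForm q) b := by
  ext i j
  simp only [formMatrix, LinearMap.coe_mk, AddHom.coe_mk, Matrix.mul_apply, Matrix.of_apply,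
    qmatForm_mGen_left, suFun_mul]

theorem formMatrix_qmatInvForm_mul (q : kˣ) (b b' : QMat q) :
    formMatrix q (qmatInvForm q) (b * b') =
      formMatrix q (qmatInvForm q) b * formMatrix q (qmatInvForm q) b' := by
  ext i j
  simp only [formMatrix, LinearMap.coe_mk, AddHom.coe_mk, Matrix.mul_apply, Matrix.of_apply,
    qmatInvForm_mul_right]
  rw [(mGen_isComatrix q).conv_apply _ _ (Finset.mem_univ i) (Finset.mem_univ j)]
  rfl

theorem formMatrix_one (q : kˣ) (F : QMat q →ₗ[k] QMat q →ₗ[k] k)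
    (hF : ∀ a, F a 1 = Coalgebra.counit a) : formMatrix q F 1 = 1 := by
  ext i j
  simp [formMatrix, hF, counit_mGen, Matrix.one_apply]

/-- Exchanging the tensor factors and reversing the indices together preserve the shape of $R$, so
the second factor is simply $R$ at $q^{-1}$. The diagonal entries are inverse to each other, and the
off-diagonal entry of the product is $q(q^{-2}-1)+(q^2-1)q^{-1}=0$. -/
theorem suMat_mul_inv (q : kˣ) (i j l m : Fin 2) :
    ∑ w, ∑ a, suMat q i a l w * suMat q⁻¹ w.rev m.rev a.rev j.rev =
      if l = m then if i = j then 1 else 0 else 0 := by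
  have hq : (q : k) ≠ 0 := q.ne_zero
  fin_cases i <;> fin_cases j <;> fin_cases l <;> fin_cases m <;> simp [suMat]
  all_goals field_simp
  all_goals ring

theorem suMat_inv_mul (q : kˣ) (i j l m : Fin 2) :
    ∑ w, ∑ a, suMat q⁻¹ l.rev w.rev i.rev a.rev * suMat q a j w m =
      if l = m then if i = j then 1 else 0 else 0 := by
  have hq : (q : k) ≠ 0 := q.ne_zero
  fin_cases i <;> fin_cases j <;> fin_cases l <;> fin_cases m <;> simp [suMat]
  all_goals field_simp
  all_goals ring

/-- The first of two stages: the first argument is a generator, and the induction is on the second.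
One matrix-valued map is antimultiplicative and the other multiplicative, so inner factors cancel in
a product. -/
theorem conv_formMatrix_qmatForm (q : kˣ) (b : QMat q) :
    conv (formMatrix q (qmatForm q)) (formMatrix q (qmatInvForm q)) b =
      algebraMap k _ (Coalgebra.counit b) := by
  induction b using qmat_induction with
  | h_scalar c =>
    rw [conv_algebraMap, formMatrix_one q _ (qmatForm_one_right q),
      formMatrix_one q _ (qmatInvForm_one_right q)]
    simp [Algebra.algebraMap_eq_smul_one]
  | h_mul b b' hb hb' =>
    exact conv_mul_of_antihom_hom (formMatrix_qmatForm_mul q) (formMatrix_qmatInvForm_mul q) hb hb'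
  | h_add b b' hb hb' => simp only [map_add, hb, hb']
  | h_gen l m =>
    rw [(mGen_isComatrix q).conv_apply _ _ (Finset.mem_univ l) (Finset.mem_univ m), counit_mGen]
    ext i j
    simp only [formMatrix, LinearMap.coe_mk, AddHom.coe_mk, Matrix.sum_apply, Matrix.mul_apply,
      Matrix.of_apply, qmatForm_mGen, qmatInvForm_mGen, suMat_mul_inv]
    split_ifs <;> simp [*]

theorem conv_formMatrix_qmatInvForm (q : kˣ) (b : QMat q) :
    conv (formMatrix q (qmatInvForm q)) (formMatrix q (qmatForm q)) b =
      algebraMap k _ (Coalgebra.counit b) := by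
  induction b using qmat_induction with
  | h_scalar c =>
    rw [conv_algebraMap, formMatrix_one q _ (qmatForm_one_right q),
      formMatrix_one q _ (qmatInvForm_one_right q)]
    simp [Algebra.algebraMap_eq_smul_one]
  | h_mul b b' hb hb' =>
    exact conv_mul_of_hom_antihom (formMatrix_qmatInvForm_mul q) (formMatrix_qmatForm_mul q) hb hb'
  | h_add b b' hb hb' => simp only [map_add, hb, hb']
  | h_gen l m =>
    rw [(mGen_isComatrix q).conv_apply _ _ (Finset.mem_univ l) (Finset.mem_univ m), counit_mGen]
    ext i j
    simp only [formMatrix, LinearMap.coe_mk, AddHom.coe_mk, Matrix.sum_apply, Matrix.mul_apply,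
      Matrix.of_apply, qmatForm_mGen, qmatInvForm_mGen, suMat_inv_mul]
    split_ifs <;> simp [*]

theorem toDual_qmatForm_mul (q : kˣ) (a b : QMat q) :
    toDual (qmatForm q) (a * b) = toDual (qmatForm q) a * toDual (qmatForm q) b :=
  WithConv.ext (LinearMap.ext fun c => qmatForm_mulLeft q a b c)

theorem toDual_qmatInvForm_mul (q : kˣ) (a b : QMat q) :
    toDual (qmatInvForm q) (a * b) = toDual (qmatInvForm q) b * toDual (qmatInvForm q) a :=
  WithConv.ext (LinearMap.ext fun c => qmatInvForm_mul_left q a b c)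

theorem toDual_one {H : Type*} [Ring H] [Bialgebra k H] {F : H →ₗ[k] H →ₗ[k] k}
    (hF : ∀ b, F 1 b = Coalgebra.counit b) : toDual F 1 = 1 :=
  WithConv.ext (LinearMap.ext fun c => hF c)

theorem conv_toDual_of_formMatrix (q : kˣ) {F G : QMat q →ₗ[k] QMat q →ₗ[k] k}
    (h : ∀ b, conv (formMatrix q F) (formMatrix q G) b = algebraMap k _ (Coalgebra.counit b))
    (i j : Fin 2) : conv (toDual F) (toDual G) (mGen q i j) =
      algebraMap k _ (Coalgebra.counit (mGen q i j)) := by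
  refine WithConv.ext (LinearMap.ext fun b => ?_)
  rw [(mGen_isComatrix q).conv_apply _ _ (Finset.mem_univ i) (Finset.mem_univ j), counit_mGen]
  have hb := congrFun (congrFun (h b) i) j
  rw [conv_formMatrix] at hb
  simp only [WithConv.ofConv_sum, LinearMap.sum_apply]
  refine hb.trans ?_
  split_ifs <;> simp [*, Matrix.algebraMap_matrix_apply]

/-- The second stage: the same cancellation, now in the first argument and with values in the
convolution algebra of functionals, with the first stage as the case of a generator. -/
theorem conv_toDual_qmatForm (q : kˣ) (a : QMat q) :
    conv (toDual (qmatForm q)) (toDual (qmatInvForm q)) a =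
      algebraMap k _ (Coalgebra.counit a) := by
  induction a using qmat_induction with
  | h_scalar c =>
    rw [conv_algebraMap, toDual_one (qmatForm_one_left q), toDual_one (qmatInvForm_one_left q)]
    simp [Algebra.algebraMap_eq_smul_one]
  | h_mul a a' ha ha' =>
    exact conv_mul_of_hom_antihom (toDual_qmatForm_mul q) (toDual_qmatInvForm_mul q) ha ha'
  | h_add a a' ha ha' => simp only [map_add, ha, ha']
  | h_gen i j => exact conv_toDual_of_formMatrix q (conv_formMatrix_qmatForm q) i j

theorem conv_toDual_qmatInvForm (q : kˣ) (a : QMat q) :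
    conv (toDual (qmatInvForm q)) (toDual (qmatForm q)) a =
      algebraMap k _ (Coalgebra.counit a) := by
  induction a using qmat_induction with
  | h_scalar c =>
    rw [conv_algebraMap, toDual_one (qmatForm_one_left q), toDual_one (qmatInvForm_one_left q)]
    simp [Algebra.algebraMap_eq_smul_one]
  | h_mul a a' ha ha' =>
    exact conv_mul_of_antihom_hom (toDual_qmatInvForm_mul q) (toDual_qmatForm_mul q) ha ha'
  | h_add a a' ha ha' => simp only [map_add, ha, ha']
  | h_gen i j => exact conv_toDual_of_formMatrix q (conv_formMatrix_qmatInvForm q) i j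

/-! ### Convolution inverses on $H\otimes H$, and pullback of forms along bialgebra maps. -/

/-- `F(a₁, b₁) G(a₂, b₂) = ε(a) ε(b)`. -/
def IsConvInverse {H : Type*} [Ring H] [Bialgebra k H] (F G : H →ₗ[k] H →ₗ[k] k) : Prop :=
  ∀ a, conv (toDual F) (toDual G) a = algebraMap k _ (Coalgebra.counit a)

theorem conv_toDual_repr {H : Type*} [Ring H] [Bialgebra k H] (F G : H →ₗ[k] H →ₗ[k] k)
    {a b : H} {ι κ : Type*} (r : Coalgebra.Repr k a ι) (s : Coalgebra.Repr k b κ) :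
    conv (toDual F) (toDual G) a b = ∑ i ∈ r.index, ∑ j ∈ s.index,
      F (r.left i) (s.left j) * G (r.right i) (s.right j) := by
  simp only [conv_apply_repr _ _ r, WithConv.ofConv_sum, LinearMap.sum_apply, s.convMul_apply]
  rfl

theorem IsConvInverse.apply {H : Type*} [Ring H] [Bialgebra k H] {F G : H →ₗ[k] H →ₗ[k] k}
    (h : IsConvInverse F G) (x : H ⊗[k] H) :
    LinearMap.mul' k k (TensorProduct.map (TensorProduct.lift F) (TensorProduct.lift G)
      (Coalgebra.comul (R := k) x)) = Coalgebra.counit (R := k) x := by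
  induction x with
  | zero => simp
  | add x y hx hy => simp only [map_add, hx, hy]
  | tmul a b =>
    have r := Coalgebra.Repr.arbitrary k a
    have s := Coalgebra.Repr.arbitrary k b
    have h' : conv (toDual F) (toDual G) a b = Coalgebra.counit a * Coalgebra.counit b := by
      rw [h a]
      simp
    rw [conv_toDual_repr F G r s] at h'
    simp only [TensorProduct.comul_tmul, ← r.eq, ← s.eq, TensorProduct.sum_tmul,
      TensorProduct.tmul_sum, map_sum,
      TensorProduct.AlgebraTensorModule.tensorTensorTensorComm_tmul, TensorProduct.map_tmul,
      LinearMap.mul'_apply, TensorProduct.lift.tmul, TensorProduct.counit_tmul, smul_eq_mul]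
    rw [Finset.sum_comm, h', mul_comm]

/-- The image of a representation of `Δ a` under a bialgebra map. -/
def reprMap {H H' : Type*} [Ring H] [Bialgebra k H] [Ring H'] [Bialgebra k H'] (φ : H →ₐc[k] H')
    {a : H} {ι : Type*} (r : Coalgebra.Repr k a ι) : Coalgebra.Repr k (φ a) ι where
  index := r.index
  left i := φ (r.left i)
  right i := φ (r.right i)
  eq := by
    rw [← CoalgHomClass.map_comp_comul_apply, ← r.eq]
    simp

theorem IsConvInverse.comp {H H' : Type*} [Ring H] [Bialgebra k H] [Ring H'] [Bialgebra k H']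
    {F G : H' →ₗ[k] H' →ₗ[k] k} (h : IsConvInverse F G) (φ : H →ₐc[k] H') :
    IsConvInverse (F.compl₁₂ (φ : H →ₐ[k] H').toLinearMap (φ : H →ₐ[k] H').toLinearMap)
      (G.compl₁₂ (φ : H →ₐ[k] H').toLinearMap (φ : H →ₐ[k] H').toLinearMap) := by
  intro a
  refine WithConv.ext (LinearMap.ext fun b => ?_)
  have r := Coalgebra.Repr.arbitrary k a
  have s := Coalgebra.Repr.arbitrary k b
  have h' := congrArg (fun f : WithConv (H' →ₗ[k] k) => f (φ b)) (h (φ a))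
  simp only [conv_toDual_repr F G (reprMap φ r) (reprMap φ s), LinearMap.convAlgebraMap_apply,
    CoalgHomClass.counit_comp_apply] at h'
  rw [conv_toDual_repr _ _ r s]
  exact h'

theorem MulLeft.comp {H H' : Type*} [Ring H] [Bialgebra k H] [Ring H'] [Bialgebra k H']
    {F : H' →ₗ[k] H' →ₗ[k] k} (h : MulLeft F) (φ : H →ₐc[k] H') :
    MulLeft (F.compl₁₂ (φ : H →ₐ[k] H').toLinearMap (φ : H →ₐ[k] H').toLinearMap) := by
  intro a b c
  simp only [LinearMap.compl₁₂_apply, AlgHom.toLinearMap_apply, map_mul]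
  rw [h]
  exact conv_comp _ _ φ c

theorem MulRight.comp {H H' : Type*} [Ring H] [Bialgebra k H] [Ring H'] [Bialgebra k H']
    {F : H' →ₗ[k] H' →ₗ[k] k} (h : MulRight F) (φ : H →ₐc[k] H') :
    MulRight (F.compl₁₂ (φ : H →ₐ[k] H').toLinearMap (φ : H →ₐ[k] H').toLinearMap) := by
  intro a b c
  simp only [LinearMap.compl₁₂_apply, AlgHom.toLinearMap_apply, map_mul]
  rw [h]
  exact conv_comp _ _ φ a

/-! ### The coaction of $M_q(2)$ on the plane and its matrix coefficients. -/

/-- The coefficient in `M` of the monomial `e_i` in an element of `A ⊗ M`. -/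
noncomputable def coef (q : kˣ) (M : Type*) [AddCommGroup M] [Module k M] (i : ℕ × ℕ) :
    Plane q ⊗[k] M →ₗ[k] M :=
  (TensorProduct.lid k M).toLinearMap ∘ₗ ((planeBasis q).coord i).rTensor M

theorem coef_tmul (q : kˣ) {M : Type*} [AddCommGroup M] [Module k M] (i : ℕ × ℕ) (a : Plane q)
    (h : M) : coef q M i (a ⊗ₜ h) = (planeBasis q).repr a i • h := by
  simp [coef]

theorem repr_mono (q : kˣ) (i j : ℕ × ℕ) :
    (planeBasis q).repr (mono q j) i = if j = i then 1 else 0 := by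
  rw [← planeBasis_apply, Module.Basis.repr_self, Finsupp.single_apply]

theorem coef_mono_tmul (q : kˣ) {M : Type*} [AddCommGroup M] [Module k M] (i j : ℕ × ℕ) (h : M) :
    coef q M i (mono q j ⊗ₜ h) = if j = i then h else 0 := by
  rw [coef_tmul, repr_mono, ite_smul, one_smul, zero_smul]

theorem mono_span_induction (q : kˣ) {P : Plane q → Prop} (zero : P 0)
    (add : ∀ a b, P a → P b → P (a + b)) (smul : ∀ (c : k) a, P a → P (c • a))
    (mono : ∀ i, P (mono q i)) (a : Plane q) : P a := by
  have ha : a ∈ Submodule.span k (Set.range (planeBasis q)) := by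
    rw [(planeBasis q).span_eq]
    trivial
  induction ha using Submodule.span_induction with
  | mem a ha =>
    obtain ⟨i, rfl⟩ := ha
    rw [planeBasis_apply]
    exact mono i
  | zero => exact zero
  | add a b _ _ ha hb => exact add a b ha hb
  | smul c a _ ha => exact smul c a ha

theorem repr_mul (q : kˣ) (m : ℕ × ℕ) (a b : Plane q) : (planeBasis q).repr (a * b) m =
    ∑ p ∈ splits m, (q : k) ^ (p.1.2 * p.2.1) *
      ((planeBasis q).repr a p.1 * (planeBasis q).repr b p.2) := by
  induction a using mono_span_induction with
  | zero => simp
  | add a a' h h' => simp only [add_mul, map_add, Finsupp.add_apply, h, h', mul_add,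
      Finset.sum_add_distrib]
  | smul c a h =>
    simp only [smul_mul_assoc, map_smul, Finsupp.smul_apply, h, smul_eq_mul, Finset.mul_sum]
    exact Finset.sum_congr rfl fun _ _ => by ring
  | mono i =>
    induction b using mono_span_induction with
    | zero => simp
    | add a a' h h' => simp only [mul_add, map_add, Finsupp.add_apply, h, h',
        Finset.sum_add_distrib]
    | smul c a h =>
      simp only [mul_smul_comm, map_smul, Finsupp.smul_apply, h, smul_eq_mul, Finset.mul_sum]
      exact Finset.sum_congr rfl fun _ _ => by ring
    | mono j =>
      simp only [mono_mul, map_smul, Finsupp.smul_apply, repr_mono, smul_eq_mul]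
      have h : ∀ p : (ℕ × ℕ) × (ℕ × ℕ), (q : k) ^ (p.1.2 * p.2.1) *
          ((if i = p.1 then 1 else 0) * (if j = p.2 then 1 else 0)) =
          if (i, j) = p then (q : k) ^ (i.2 * j.1) else 0 := by
        rintro ⟨u, v⟩
        by_cases hu : i = u <;> by_cases hv : j = v <;> simp [hu, hv]
      simp only [h, Finset.sum_ite_eq, mem_splits]
      simp

/-- The source of the comeasuring relations: applied to the product of the images of two monomials
under the coaction, the right side is the left side of such a relation. -/
theorem coef_mul (q : kˣ) {B : Type*} [Ring B] [Algebra k B] (m : ℕ × ℕ) (x y : Plane q ⊗[k] B) :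
    coef q B m (x * y) =
      ∑ p ∈ splits m, (q : k) ^ (p.1.2 * p.2.1) • (coef q B p.1 x * coef q B p.2 y) := by
  induction x with
  | zero => simp
  | add x x' h h' => simp only [add_mul, map_add, h, h', smul_add, Finset.sum_add_distrib]
  | tmul a b =>
    induction y with
    | zero => simp
    | add x x' h h' => simp only [mul_add, map_add, h, h', smul_add, Finset.sum_add_distrib]
    | tmul a' b' =>
      simp only [Algebra.TensorProduct.tmul_mul_tmul, coef_tmul, repr_mul, Finset.sum_smul,
        smul_mul_assoc, mul_smul_comm, smul_smul]
      exact Finset.sum_congr rfl fun p _ => by rw [mul_comm ((planeBasis q).repr a' p.2)]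

/-- The coaction of `M_q(2)` on the quantum plane. -/
noncomputable def coaction (q : kˣ) : Plane q →ₐ[k] Plane q ⊗[k] QMat q :=
  planeLift q (fun j => ∑ i, coord q i ⊗ₜ[k] mGen q i j) (by
    obtain ⟨h₁, h₂, h₃, h₄, h₅, h₆⟩ := mGen_isQMat q
    have h₇ := sub_eq_iff_eq_add.1 h₆
    have hq : (q : k) ≠ 0 := q.ne_zero
    -- The coefficients of $x^2$, $y^2$ and $xy$ give $ba=qab$, $dc=qcd$ and, using $cb=bc$,
    -- $q(da-ad)=(q^2-1)bc$.
    simp only [Fin.sum_univ_two, mul_add, add_mul, Algebra.TensorProduct.tmul_mul_tmul,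
      h₁, h₄, h₅, h₇, coord_rel, TensorProduct.tmul_add,
      TensorProduct.tmul_smul, ← TensorProduct.smul_tmul']
    match_scalars
    all_goals field_simp
    all_goals ring)

theorem coaction_coord (q : kˣ) (j : Fin 2) :
    coaction q (coord q j) = ∑ i, coord q i ⊗ₜ[k] mGen q i j :=
  planeLift_coord q _ _ j

/-- The matrix coefficients of the coaction of `M_q(2)` on the quantum plane in the basis of
monomials. -/
noncomputable def coactionMat (q : kˣ) (i j : ℕ × ℕ) : QMat q :=
  coef q (QMat q) i (coaction q (mono q j))

theorem plane_hom_ext (q : kˣ) {B : Type*} [Semiring B] [Algebra k B] {f g : Plane q →ₐ[k] B}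
    (h : ∀ i, f (coord q i) = g (coord q i)) : f = g :=
  RingQuot.ringQuot_ext' k f g (FreeAlgebra.hom_ext (funext h))

/-- Homogeneity fixes the finite index set of the expansion. Both sides are linear in `x`, so it is
enough to compare them on $e_i\otimes h$. -/
theorem sum_coef_of_mem (q : kˣ) {M : Type*} [AddCommGroup M] [Module k M] {n : ℕ}
    {x : Plane q ⊗[k] M}
    (hx : x ∈ Submodule.map₂ (TensorProduct.mk k (Plane q) M) (homog q n) ⊤) :
    x = ∑ i ∈ ofDeg n, mono q i ⊗ₜ coef q M i x := by
  let F : Plane q ⊗[k] M →ₗ[k] Plane q ⊗[k] M :=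
    ∑ i ∈ ofDeg n, TensorProduct.mk k _ _ (mono q i) ∘ₗ coef q M i
  have hF : ∀ x, F x = ∑ i ∈ ofDeg n, mono q i ⊗ₜ coef q M i x := by
    intro x
    simp [F]
  rw [← hF]
  suffices h : Submodule.map₂ (TensorProduct.mk k (Plane q) M) (homog q n) ⊤ ≤
      LinearMap.eqLocus LinearMap.id F from h hx
  refine Submodule.map₂_le.2 fun a ha h _ => ?_
  induction ha using Submodule.span_induction with
  | mem a ha =>
    obtain ⟨i, hi, rfl⟩ := ha
    simp only [LinearMap.mem_eqLocus, LinearMap.id_apply, TensorProduct.mk_apply, hF,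
      coef_mono_tmul]
    rw [Finset.sum_eq_single i]
    · simp
    · intro j _ hj
      simp [hj.symm]
    · intro h
      exact absurd (mem_ofDeg.2 hi) h
  | zero => simp
  | add a b _ _ ha hb => rw [map_add, LinearMap.add_apply]; exact Submodule.add_mem _ ha hb
  | smul c a _ ha => rw [map_smul, LinearMap.smul_apply]; exact Submodule.smul_mem _ _ ha

theorem coaction_mem (q : kˣ) (j : ℕ × ℕ) : coaction q (mono q j) ∈
    Submodule.map₂ (TensorProduct.mk k (Plane q) (QMat q)) (homog q (deg j)) ⊤ := by
  refine mono_induction q (P := fun n a => coaction q a ∈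
    Submodule.map₂ (TensorProduct.mk k (Plane q) (QMat q)) (homog q n) ⊤) ?_ ?_ j
  · rw [map_one]
    exact Submodule.apply_mem_map₂ _ (one_mem_homog q) trivial
  · intro n j a ha
    rw [map_mul, coaction_coord, Finset.sum_mul]
    refine Submodule.sum_mem _ fun i _ => ?_
    have h : Submodule.map₂ (TensorProduct.mk k (Plane q) (QMat q)) (homog q n) ⊤ ≤
        (Submodule.map₂ (TensorProduct.mk k (Plane q) (QMat q)) (homog q (n + 1)) ⊤).comap
          (LinearMap.mulLeft k (coord q i ⊗ₜ[k] mGen q i j)) := by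
      refine Submodule.map₂_le.2 fun u hu v _ => ?_
      simp only [Submodule.mem_comap, LinearMap.mulLeft_apply, TensorProduct.mk_apply,
        Algebra.TensorProduct.tmul_mul_tmul]
      rw [add_comm n 1]
      exact Submodule.apply_mem_map₂ _ (homog_mul q (coord_mem_homog q i) hu) trivial
    exact h ha

theorem coaction_mono (q : kˣ) (j : ℕ × ℕ) :
    coaction q (mono q j) = ∑ i ∈ ofDeg (deg j), mono q i ⊗ₜ coactionMat q i j :=
  sum_coef_of_mem q (coaction_mem q j)

theorem coef_sum_mono (q : kˣ) {M : Type*} [AddCommGroup M] [Module k M] (s : Finset (ℕ × ℕ))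
    (h : ℕ × ℕ → M) (i : ℕ × ℕ) :
    coef q M i (∑ j ∈ s, mono q j ⊗ₜ h j) = if i ∈ s then h i else 0 := by
  simp [coef_mono_tmul]

/-- The coaction preserves degree. This is what makes $p$ kill $s_I$ and $t_I$ for $|I|\ge2$. -/
theorem coactionMat_eq_zero (q : kˣ) {i j : ℕ × ℕ} (h : deg i ≠ deg j) : coactionMat q i j = 0 := by
  rw [coactionMat, coaction_mono, coef_sum_mono, if_neg (by rwa [mem_ofDeg])]

/-- Both sides are algebra maps of the plane, so it suffices to compare them on $x$ and $y$, where
this is the matrix coproduct. -/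
theorem coaction_coassoc (q : kˣ) (a : Plane q) :
    TensorProduct.assoc k _ _ _ ((coaction q).toLinearMap.rTensor (QMat q) (coaction q a)) =
      (Coalgebra.comul (R := k) (A := QMat q)).lTensor (Plane q) (coaction q a) := by
  have h : ((Algebra.TensorProduct.assoc k k k (Plane q) (QMat q) (QMat q)).toAlgHom.comp
      (Algebra.TensorProduct.map (coaction q) (AlgHom.id k (QMat q)))).comp (coaction q) =
      (Algebra.TensorProduct.map (AlgHom.id k (Plane q)) (Bialgebra.comulAlgHom k (QMat q))).comp
        (coaction q) := by
    refine plane_hom_ext q fun j => ?_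
    simp [coaction_coord, comul_mGen, TensorProduct.sum_tmul, TensorProduct.tmul_sum, -Fin.sum_univ_two]
    exact Finset.sum_comm
  exact congrArg (fun f : _ →ₐ[k] _ => f a) h

theorem comul_coactionMat (q : kˣ) (i j : ℕ × ℕ) : Coalgebra.comul (R := k) (coactionMat q i j) =
    ∑ a ∈ ofDeg (deg j), coactionMat q i a ⊗ₜ[k] coactionMat q a j := by
  by_cases h : i ∈ ofDeg (deg j)
  · have hc := congrArg (coef q (QMat q ⊗[k] QMat q) i) (coaction_coassoc q (mono q j))
    simp only [coaction_mono, map_sum, LinearMap.rTensor_tmul, LinearMap.lTensor_tmul,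
      AlgHom.toLinearMap_apply, TensorProduct.sum_tmul, TensorProduct.assoc_tmul,
      coef_mono_tmul, Finset.sum_ite_eq', if_pos h] at hc
    rw [← hc]
    refine Finset.sum_congr rfl fun a ha => ?_
    rw [if_pos]
    rw [mem_ofDeg] at *
    rw [h, ha]
  · rw [mem_ofDeg] at h
    rw [coactionMat_eq_zero q h, map_zero, Finset.sum_eq_zero]
    intro a ha
    rw [coactionMat_eq_zero q (by rwa [mem_ofDeg.1 ha]), TensorProduct.zero_tmul]

theorem counit_coactionMat (q : kˣ) (i j : ℕ × ℕ) :
    Coalgebra.counit (R := k) (coactionMat q i j) = if i = j then 1 else 0 := by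
  have h : ((Algebra.TensorProduct.rid k k (Plane q)).toAlgHom.comp
      (Algebra.TensorProduct.map (AlgHom.id k (Plane q)) (Bialgebra.counitAlgHom k (QMat q)))).comp
        (coaction q) = AlgHom.id k (Plane q) := by
    refine plane_hom_ext q fun j => ?_
    simp [coaction_coord, counit_mGen, -Fin.sum_univ_two]
  have h' := congrArg (fun x => (planeBasis q).repr x i)
    (congrArg (fun f : _ →ₐ[k] _ => f (mono q j)) h)
  simp [coaction_mono, repr_mono] at h'
  simp only [@eq_comm _ i j]
  rw [← h']
  split_ifs with hi
  · rfl
  · rw [coactionMat_eq_zero q (by rwa [mem_ofDeg] at hi), map_zero]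

theorem coactionMat_low (q : kˣ) (i j : Fin 2) : coactionMat q (low i) (low j) = mGen q i j := by
  have h : ∀ i, mono q (low i) = coord q i := by
    intro i
    fin_cases i <;> simp [low, mono]
  have hl : ∀ a b, (low a = low b) ↔ a = b := by decide
  rw [coactionMat, h, coaction_coord]
  simp only [← h, map_sum, coef_mono_tmul, hl, Finset.sum_ite_eq', Finset.mem_univ, if_true]

/-! ### The braiding as the one induced by the coaction and the form. -/

/-- The operator `a ↦ a₀ R₂(a₁, h)` on the quantum plane. -/
noncomputable def formOp (q : kˣ) (h : QMat q) : Module.End k (Plane q) :=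
  (TensorProduct.rid k (Plane q)).toLinearMap ∘ₗ ((qmatForm q).flip h).lTensor (Plane q) ∘ₗ
    (coaction q).toLinearMap

theorem formOp_mono (q : kˣ) (h : QMat q) (j : ℕ × ℕ) : formOp q h (mono q j) =
    ∑ i ∈ ofDeg (deg j), qmatForm q (coactionMat q i j) h • mono q i := by
  simp [formOp, coaction_mono]

theorem formOp_mul (q : kˣ) (h h' : QMat q) : formOp q (h' * h) = formOp q h * formOp q h' := by
  refine (planeBasis q).ext fun j => ?_
  simp only [planeBasis_apply, Module.End.mul_apply, formOp_mono, map_sum, map_smul,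
    qmatForm_mulRight q (coactionMat q _ j), Finset.smul_sum, smul_smul]
  have hc : ∀ i, conv ((qmatForm q).flip h) ((qmatForm q).flip h') (coactionMat q i j) =
      ∑ a ∈ ofDeg (deg j), qmatForm q (coactionMat q i a) h * qmatForm q (coactionMat q a j) h' := by
    intro i
    simp [conv, comul_coactionMat]
  simp only [hc, Finset.sum_smul]
  rw [Finset.sum_comm]
  refine Finset.sum_congr rfl fun a ha => ?_
  rw [mem_ofDeg.1 ha]
  exact Finset.sum_congr rfl fun i _ => by rw [mul_comm]

theorem formOp_one (q : kˣ) : formOp q 1 = 1 := by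
  refine (planeBasis q).ext fun j => ?_
  simp [formOp_mono, qmatForm_one_right, counit_coactionMat, mem_ofDeg]

theorem formOp_add (q : kˣ) (h h' : QMat q) : formOp q (h + h') = formOp q h + formOp q h' :=
  LinearMap.ext fun a => by simp [formOp, LinearMap.lTensor_add]

theorem formOp_smul (q : kˣ) (c : k) (h : QMat q) : formOp q (c • h) = c • formOp q h :=
  LinearMap.ext fun a => by simp [formOp, LinearMap.lTensor_smul]

/-- `formOp` as an algebra map. -/
noncomputable def formOpHom (q : kˣ) : QMat q →ₐ[k] (Module.End k (Plane q))ᵐᵒᵖ :=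
  AlgHom.ofLinearMap
    { toFun := fun h => MulOpposite.op (formOp q h)
      map_add' := fun h h' => by rw [formOp_add, MulOpposite.op_add]
      map_smul' := fun c h => by rw [formOp_smul, MulOpposite.op_smul, RingHom.id_apply] }
    (congrArg MulOpposite.op (formOp_one q))
    (fun h h' => congrArg MulOpposite.op (formOp_mul q h' h))

theorem formOpHom_apply (q : kˣ) (h : QMat q) : formOpHom q h = MulOpposite.op (formOp q h) := rfl

/-- Left multiplicativity of the form, read on the plane: these operators obey the same product rule
as `braidOp`, the rule that expresses functoriality of $\Psi$ in its first argument. -/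
theorem formOp_mGen_mul (q : kˣ) (j i : Fin 2) (a b : Plane q) : formOp q (mGen q j i) (a * b) =
    ∑ l, formOp q (mGen q j l) a * formOp q (mGen q l i) b := by
  simp only [formOp, LinearMap.comp_apply, AlgHom.toLinearMap_apply, map_mul]
  induction coaction q a with
  | zero => simp
  | add x x' h h' => simp only [add_mul, map_add, h, h', Finset.sum_add_distrib]
  | tmul a h =>
    induction coaction q b with
    | zero => simp
    | add x x' h h' => simp only [mul_add, map_add, h, h', Finset.sum_add_distrib]
    | tmul b h' =>
      simp only [Algebra.TensorProduct.tmul_mul_tmul, LinearMap.lTensor_tmul, LinearEquiv.coe_coe,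
        TensorProduct.rid_tmul, LinearMap.flip_apply, qmatForm_mulLeft q h h']
      rw [(mGen_isComatrix q).conv_apply _ _ (Finset.mem_univ j) (Finset.mem_univ i),
        Finset.sum_smul]
      refine Finset.sum_congr rfl fun l _ => ?_
      rw [smul_mul_smul_comm]

/-- With equal product rules only the values on $x$ and $y$ matter. There the prescribed values of
$\Psi$ are the entries of $R_{su_2}$. -/
theorem formOp_mGen (q : kˣ) (j i : Fin 2) : formOp q (mGen q j i) = braidOp q j i := by
  ext a
  induction a using plane_induction generalizing j i with
  | h_scalar c =>
    rw [braidOp_algebraMap, formOp]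
    simp [Algebra.TensorProduct.algebraMap_apply, qmatForm_one_left, counit_mGen]
  | h_coord l =>
    simp only [formOp, LinearMap.comp_apply, AlgHom.toLinearMap_apply, coaction_coord, map_sum,
      LinearMap.lTensor_tmul, LinearEquiv.coe_coe, TensorProduct.rid_tmul, LinearMap.flip_apply,
      qmatForm_mGen]
    fin_cases l <;> fin_cases j <;> fin_cases i <;> simp [suMat, braidOp, braidGen_x, braidGen_y]
  | h_mul a b ha hb => simp only [formOp_mGen_mul, ha, hb, braidOp_mul, Fin.sum_univ_two]
  | h_add a b ha hb => simp only [map_add, ha, hb]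

/-- Both are algebra maps of the plane with the same values on the coordinates; functoriality of
$\Psi$ in its second argument thus corresponds to right multiplicativity of the form. -/
theorem braidRight_eq (q : kˣ) : braidRight q =
    (Algebra.TensorProduct.map (AlgHom.id k (Plane q)) (formOpHom q)).comp (coaction q) := by
  refine plane_hom_ext q fun i => ?_
  simp [braidRight, coaction_coord, formOpHom_apply, formOp_mGen, -Fin.sum_univ_two]

/-- The braiding of the quantum plane is induced by its coaction of `M_q(2)`. -/
theorem braidMat_eq (q : kˣ) (a i b j : ℕ × ℕ) :
    braidMat q a i b j = qmatForm q (coactionMat q a i) (coactionMat q b j) := by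
  by_cases h : deg a ≠ deg i ∨ deg b ≠ deg j
  · rw [braidMat_eq_zero q h]
    rcases h with h | h
    · rw [coactionMat_eq_zero q h, map_zero, LinearMap.zero_apply]
    · rw [coactionMat_eq_zero q h, map_zero]
  · push Not at h
    rw [braidMat, braiding_tmul, braidRight_eq]
    simp [coaction_mono, formOpHom_apply, formOp_mono, repr_mono, mem_ofDeg, h,
      Module.Basis.tensorProduct_repr_tmul_apply]

theorem braidMat_low (q : kˣ) (i j l m : Fin 2) :
    braidMat q (low i) (low j) (low l) (low m) = suMat q i j l m := by
  rw [braidMat_eq, coactionMat_low, coactionMat_low, qmatForm_mGen]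

/-! ### The bialgebra maps $p$ and $\iota$. -/

/-- The surjection `M₀(R, A) → M_q(2)` as an algebra map. -/
noncomputable def comeasToQMatAlg (q : kˣ) : Comeas q →ₐ[k] QMat q :=
  comeasLift q (coactionMat q)
    (by
      intro m i j
      have h := congrArg (coef q (QMat q) m) (map_mul (coaction q) (mono q i) (mono q j))
      rw [coef_mul, mono_mul, map_smul, map_smul] at h
      exact h.symm)
    (by
      intro i j m n
      -- By `braidMat_eq` the commutation axiom for matrix coefficients is the $R$-relation.
      have h := qmatForm_commAt q (coactionMat q i m) (coactionMat q j n)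
      rw [commAt_iff_repr
        ⟨ofDeg (deg m), fun a => coactionMat q i a, fun a => coactionMat q a m,
          (comul_coactionMat q i m).symm⟩
        ⟨ofDeg (deg n), fun a => coactionMat q j a, fun a => coactionMat q a n,
          (comul_coactionMat q j n).symm⟩] at h
      simp only [← braidMat_eq] at h
      rw [h]
      -- The axiom sums over the degrees of `m` and `n` where the relation has those of `i` and `j`.
      -- If the degrees differ, every term is zero.
      by_cases hd : deg i = deg m ∧ deg j = deg n
      · rw [hd.1, hd.2]
      · have hz : ∀ (s t : Finset (ℕ × ℕ)), ∑ a ∈ s, ∑ b ∈ t,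
            braidMat q i a j b • (coactionMat q a m * coactionMat q b n) = 0 := by
          intro s t
          refine Finset.sum_eq_zero fun a _ => Finset.sum_eq_zero fun b _ => ?_
          by_contra hne
          apply hd
          constructor
          · by_contra hi
            apply hne
            by_cases ha : deg a = deg m
            · rw [braidMat_eq_zero q (Or.inl (by change deg i ≠ deg a; rwa [ha])), zero_smul]
            · rw [coactionMat_eq_zero q ha, zero_mul, smul_zero]
          · by_contra hi
            apply hne
            by_cases ha : deg b = deg n
            · rw [braidMat_eq_zero q (Or.inr (by change deg j ≠ deg b; rwa [ha])), zero_smul]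
            · rw [coactionMat_eq_zero q ha, mul_zero, smul_zero]
        rw [hz, hz])
    (by
      rw [coactionMat, show (0 : ℕ × ℕ) = (0, 0) from rfl, mono_zero, map_one,
        Algebra.TensorProduct.one_def, ← mono_zero, coef_mono_tmul, if_pos rfl])
    (by
      intro i hi
      rw [coactionMat, show (0 : ℕ × ℕ) = (0, 0) from rfl, mono_zero, map_one,
        Algebra.TensorProduct.one_def, ← mono_zero, coef_mono_tmul, if_neg]
      exact hi.symm)
    (by
      intro i hi
      refine coactionMat_eq_zero q fun h => hi ?_
      simp only [deg, Prod.fst_zero, Prod.snd_zero] at h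
      ext <;> simp <;> omega)

theorem comeasToQMatAlg_tGen (q : kˣ) (i j : ℕ × ℕ) :
    comeasToQMatAlg q (tGen q i j) = coactionMat q i j :=
  comeasLift_tGen q _ _ _ _ _ _ i j

theorem sum_upTo_eq {M : Type*} [AddCommMonoid M] {f : ℕ × ℕ → M} {m n : ℕ} (hm : m ≤ n)
    (h : ∀ a, deg a ≠ m → f a = 0) : ∑ a ∈ upTo n, f a = ∑ a ∈ ofDeg m, f a := by
  symm
  refine Finset.sum_subset (fun a ha => ?_) fun a _ ha => h a (by rwa [mem_ofDeg] at ha)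
  rw [mem_ofDeg] at ha
  rw [mem_upTo, ha]
  exact hm

/-- The surjection `M₀(R, A) → M_q(2)`. -/
noncomputable def comeasToQMat (q : kˣ) : Comeas q →ₐc[k] QMat q :=
  BialgHom.ofAlgHom (comeasToQMatAlg q)
    (comeas_hom_ext q fun i j => by
      simp only [AlgHom.comp_apply, comeasToQMatAlg_tGen, Bialgebra.counitAlgHom_apply,
        counit_coactionMat, counit_tGen])
    (comeas_hom_ext q fun i j => by
      simp only [AlgHom.comp_apply, comeasToQMatAlg_tGen, Bialgebra.comulAlgHom_apply,
        comul_tGen, comul_coactionMat, map_sum, Algebra.TensorProduct.map_tmul]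
      have hz : ∀ a, deg i ≠ deg j ∨ deg a ≠ deg j →
          coactionMat q i a ⊗ₜ[k] coactionMat q a j = 0 := by
        intro a h
        by_cases ha : deg a = deg j
        · rw [coactionMat_eq_zero q (i := i) (by rw [ha]; tauto), TensorProduct.zero_tmul]
        · rw [coactionMat_eq_zero q ha, TensorProduct.tmul_zero]
      by_cases h : deg i = deg j
      · rw [h]
        exact sum_upTo_eq le_rfl fun a ha => hz a (Or.inr ha)
      · rw [Finset.sum_eq_zero fun a _ => hz a (Or.inl h),
          Finset.sum_eq_zero fun a _ => hz a (Or.inl h)])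

theorem comeasToQMat_tGen (q : kˣ) (i j : ℕ × ℕ) :
    comeasToQMat q (tGen q i j) = coactionMat q i j :=
  comeasToQMatAlg_tGen q i j

/-- Since $\Psi$ preserves degrees and restricts to $R_{su_2}$ on the span of $x$ and $y$, the
$R$-relations for indices of degree one involve only these four generators. -/
theorem tGen_low_isQMat (q : kˣ) : IsQMat q fun i j => tGen q (low i) (low j) := by
  refine IsRTT.isQMat fun i j m n => ?_
  have h := tGen_rtt q (low i) (low j) (low m) (low n)
  have hl : ∀ i, ofDeg (deg (low i)) = Finset.univ.image low := by decide
  have hi : Function.Injective low := by decide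
  simpa only [hl, Finset.sum_image hi.injOn, braidMat_low] using h

/-- The inclusion `M_q(2) → M₀(R, A)`. -/
noncomputable def qmatToComeas (q : kˣ) : QMat q →ₐc[k] Comeas q :=
  BialgHom.ofAlgHom (qmatLift q _ (tGen_low_isQMat q))
    (qmat_hom_ext q fun i j => by
      have hl : ∀ a b, (low a = low b) ↔ a = b := by decide
      simp only [AlgHom.comp_apply, qmatLift_mGen, Bialgebra.counitAlgHom_apply,
        counit_mGen, counit_tGen, hl])
    (qmat_hom_ext q fun i j => by
      simp only [AlgHom.comp_apply, qmatLift_mGen, Bialgebra.comulAlgHom_apply,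
        comul_mGen, comul_tGen, map_sum, Algebra.TensorProduct.map_tmul]
      -- In $M_0$ the coproduct of a lowest-level generator also runs over the index $0$; that term
      -- vanishes because $t^I{}_0=0$ for $I\ne0$.
      have hl : ∀ i, upTo (deg (low i)) = insert 0 (Finset.univ.image low) := by decide
      have h0 : 0 ∉ Finset.univ.image low := by decide
      have hi : Function.Injective low := by decide
      have hn : low i ≠ 0 := by revert i; decide
      rw [hl, Finset.sum_insert h0, Finset.sum_image hi.injOn, tGen_col q hn,
        TensorProduct.zero_tmul, zero_add])

theorem qmatToComeas_mGen (q : kˣ) (i j : Fin 2) :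
    qmatToComeas q (mGen q i j) = tGen q (low i) (low j) :=
  qmatLift_mGen q _ _ i j

theorem comeasToQMat_qmatToComeas (q : kˣ) (x : QMat q) :
    comeasToQMat q (qmatToComeas q x) = x := by
  have h : (comeasToQMat q : Comeas q →ₐ[k] QMat q).comp (qmatToComeas q : QMat q →ₐ[k] Comeas q) =
      AlgHom.id k (QMat q) := by
    refine qmat_hom_ext q fun i j => ?_
    exact ((congrArg (comeasToQMat q) (qmatToComeas_mGen q i j)).trans
      (comeasToQMat_tGen q _ _)).trans (coactionMat_low q i j)
  exact congrArg (fun f : _ →ₐ[k] _ => f x) h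

theorem adjoin_range_mGen (q : kˣ) :
    Algebra.adjoin k (Set.range fun ij : Fin 2 × Fin 2 => mGen q ij.1 ij.2) = ⊤ := by
  rw [eq_top_iff]
  intro x _
  induction x using qmat_induction with
  | h_scalar c => exact Subalgebra.algebraMap_mem _ c
  | h_gen i j => exact Algebra.subset_adjoin ⟨(i, j), rfl⟩
  | h_mul a b ha hb => exact Subalgebra.mul_mem _ (ha trivial) (hb trivial)
  | h_add a b ha hb => exact Subalgebra.add_mem _ (ha trivial) (hb trivial)

/-! ### The dual quasitriangular structure of $M_0$. -/

/-- The dual quasitriangular structure of `M₀(R, A)`. -/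
noncomputable def comeasForm (q : kˣ) : Comeas q →ₗ[k] Comeas q →ₗ[k] k :=
  (qmatForm q).compl₁₂ (comeasToQMat q : Comeas q →ₐ[k] QMat q).toLinearMap
    (comeasToQMat q : Comeas q →ₐ[k] QMat q).toLinearMap

theorem comeasForm_apply (q : kˣ) (x y : Comeas q) :
    comeasForm q x y = qmatForm q (comeasToQMat q x) (comeasToQMat q y) := rfl

theorem comeasForm_tGen (q : kˣ) (i j l m : ℕ × ℕ) :
    comeasForm q (tGen q i j) (tGen q l m) = braidMat q i j l m := by
  rw [comeasForm_apply, comeasToQMat_tGen, comeasToQMat_tGen, braidMat_eq]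

theorem comul_tGen_of_le (q : kˣ) {i : ℕ × ℕ} {n : ℕ} (hi : deg i ≤ n) (j : ℕ × ℕ) :
    Coalgebra.comul (R := k) (tGen q i j) = ∑ a ∈ upTo n, tGen q i a ⊗ₜ[k] tGen q a j := by
  rw [comul_tGen]
  refine Finset.sum_subset (fun a ha => ?_) (fun a _ ha => ?_)
  · rw [mem_upTo] at *
    omega
  · rw [mem_upTo, not_le] at ha
    rw [tGen_eq_zero q ha, TensorProduct.zero_tmul]

/-- Enlarging the index set of the coproduct adds only zero terms, so each block of bounded degree
is a finite comatrix, as `IsComatrix.commAt_mul_right` requires. -/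
theorem tGen_isComatrix (q : kˣ) (n : ℕ) : IsComatrix (k := k) (upTo n) (tGen q) :=
  fun _ hi j _ => comul_tGen_of_le q (mem_upTo.1 hi) j

theorem comeasForm_one_left (q : kˣ) (b : Comeas q) :
    comeasForm q 1 b = Coalgebra.counit b := by
  rw [comeasForm_apply, map_one, qmatForm_one_left]
  exact CoalgHomClass.counit_comp_apply _ _

theorem comeasForm_one_right (q : kˣ) (b : Comeas q) :
    comeasForm q b 1 = Coalgebra.counit b := by
  rw [comeasForm_apply, map_one, qmatForm_one_right]
  exact CoalgHomClass.counit_comp_apply _ _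

/-- Pulling the axiom back from $M_q(2)$ would give it only after applying $p$. For two generators
it is instead the $R$-relation imposed on $M_0$, because the form takes the values `braidMat` on
them. -/
theorem comeasForm_commAt (q : kˣ) (a b : Comeas q) : CommAt (comeasForm q) a b := by
  have hL : MulLeft (comeasForm q) := (qmatForm_mulLeft q).comp _
  have hR : MulRight (comeasForm q) := (qmatForm_mulRight q).comp _
  induction a using comeas_induction generalizing b with
  | h_scalar r => exact commAt_algebraMap_left (comeasForm_one_left q) r b
  | h_mul a a' ha ha' => exact commAt_mul_left hL ha ha' b
  | h_add a a' ha ha' => exact (ha b).add_left (ha' b)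
  | h_gen i j =>
    suffices ∀ n, ∀ i ∈ upTo n, ∀ j ∈ upTo n, CommAt (comeasForm q) (tGen q i j) b from
      this (max (deg i) (deg j)) i (mem_upTo.2 (le_max_left _ _)) j (mem_upTo.2 (le_max_right _ _))
    intro n
    induction b using comeas_induction with
    | h_scalar r => exact fun i _ j _ => commAt_algebraMap_right (comeasForm_one_right q) r _
    | h_mul b b' hb hb' => exact (tGen_isComatrix q n).commAt_mul_right hR hb hb'
    | h_add b b' hb hb' => exact fun i hi j hj => (hb i hi j hj).add_right (hb' i hi j hj)
    | h_gen l m =>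
      intro i hi j hj
      rw [commAt_iff_repr
        ⟨upTo n, fun a => tGen q i a, fun a => tGen q a j, (tGen_isComatrix q n i hi j hj).symm⟩
        ⟨upTo (max (deg l) (deg m)), fun a => tGen q l a, fun a => tGen q a m,
          (comul_tGen_of_le q (le_max_left (deg l) (deg m)) m).symm⟩]
      simp only [comeasForm_tGen]
      -- The coproducts run over all degrees up to a bound; since `braidMat` preserves degrees, only
      -- the single degrees that occur in the $R$-relation survive.
      have hl : ∀ a, ∑ b ∈ upTo (max (deg l) (deg m)),
          braidMat q a j b m • (tGen q l b * tGen q i a) =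
            ∑ b ∈ ofDeg (deg m), braidMat q a j b m • (tGen q l b * tGen q i a) := fun a =>
        sum_upTo_eq (le_max_right _ _) fun b hb => by
          rw [braidMat_eq_zero q (Or.inr hb), zero_smul]
      have hr : ∀ a, ∑ b ∈ upTo (max (deg l) (deg m)),
          braidMat q i a l b • (tGen q a j * tGen q b m) =
            ∑ b ∈ ofDeg (deg l), braidMat q i a l b • (tGen q a j * tGen q b m) := fun a =>
        sum_upTo_eq (le_max_left _ _) fun b hb => by
          rw [braidMat_eq_zero q (Or.inr fun h => hb h.symm), zero_smul]
      simp only [hl, hr]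
      rw [sum_upTo_eq (mem_upTo.1 hj) fun a ha => Finset.sum_eq_zero fun b _ => by
          rw [braidMat_eq_zero q (Or.inl ha), zero_smul],
        sum_upTo_eq (mem_upTo.1 hi) fun a ha => Finset.sum_eq_zero fun b _ => by
          rw [braidMat_eq_zero q (Or.inl fun h => ha h.symm), zero_smul]]
      exact (tGen_rtt q i l j m).symm

theorem isDualQuasitriangular_of_isConvInverse {H : Type*} [Ring H] [Bialgebra k H]
    {R S : H →ₗ[k] H →ₗ[k] k} (hL : MulLeft R) (hR : MulRight R) (hc : ∀ a b, CommAt R a b)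
    (hRS : IsConvInverse R S) (hSR : IsConvInverse S R) : IsDualQuasitriangular R where
  mul_left := hL
  mul_right := hR
  comm := hc
  invertible := ⟨TensorProduct.lift S, fun x => ⟨hRS.apply x, hSR.apply x⟩⟩

theorem qmatForm_isDualQuasitriangular (q : kˣ) : IsDualQuasitriangular (qmatForm q) :=
  isDualQuasitriangular_of_isConvInverse (qmatForm_mulLeft q) (qmatForm_mulRight q)
    (qmatForm_commAt q) (conv_toDual_qmatForm q) (conv_toDual_qmatInvForm q)

theorem comeasForm_isDualQuasitriangular (q : kˣ) : IsDualQuasitriangular (comeasForm q) :=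
  isDualQuasitriangular_of_isConvInverse ((qmatForm_mulLeft q).comp _) ((qmatForm_mulRight q).comp _)
    (comeasForm_commAt q) (IsConvInverse.comp (conv_toDual_qmatForm q) _)
    (IsConvInverse.comp (conv_toDual_qmatInvForm q) _)

end
end QuantumPlane

theorem corollary4p4 {k : Type*} [Field k] (q : kˣ) :
    ∃ (p : QuantumPlane.Comeas q →ₐc[k] QuantumPlane.QMat q)
      (ι : QuantumPlane.QMat q →ₐc[k] QuantumPlane.Comeas q)
      (R : QuantumPlane.Comeas q →ₗ[k] QuantumPlane.Comeas q →ₗ[k] k)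
      (R₂ : QuantumPlane.QMat q →ₗ[k] QuantumPlane.QMat q →ₗ[k] k),
      -- the bialgebra surjection, which kills the higher-level generators `s_I`, `t_I`
      Function.Surjective p ∧
      (∀ i j : Fin 2, p (QuantumPlane.tGen q (QuantumPlane.low i) (QuantumPlane.low j)) =
        QuantumPlane.mGen q i j) ∧
      (∀ (I : ℕ × ℕ) (j : Fin 2), 2 ≤ QuantumPlane.deg I →
        p (QuantumPlane.tGen q I (QuantumPlane.low j)) = 0) ∧
      -- the lowest-level generators generate a copy of `M_q(2)` covered by the surjection
      Function.Injective ι ∧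
      (∀ i j : Fin 2, ι (QuantumPlane.mGen q i j) =
        QuantumPlane.tGen q (QuantumPlane.low i) (QuantumPlane.low j)) ∧
      (ι : QuantumPlane.QMat q →ₐ[k] QuantumPlane.Comeas q).range =
        Algebra.adjoin k (Set.range fun ij : Fin 2 × Fin 2 =>
          QuantumPlane.tGen q (QuantumPlane.low ij.1) (QuantumPlane.low ij.2)) ∧
      (∀ x, p (ι x) = x) ∧
      -- the dual quasitriangular structures, and that the first extends the second
      QuantumPlane.IsDualQuasitriangular R ∧
      (∀ I J K L : ℕ × ℕ, R (QuantumPlane.tGen q I J) (QuantumPlane.tGen q K L) =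
        QuantumPlane.braidMat q I J K L) ∧
      QuantumPlane.IsDualQuasitriangular R₂ ∧
      (∀ i j l m : Fin 2, R₂ (QuantumPlane.mGen q i j) (QuantumPlane.mGen q l m) =
        QuantumPlane.suMat q i j l m) ∧
      (∀ x y, R (ι x) (ι y) = R₂ x y) := by
  refine ⟨QuantumPlane.comeasToQMat q, QuantumPlane.qmatToComeas q, QuantumPlane.comeasForm q,
    QuantumPlane.qmatForm q, fun x => ⟨_, QuantumPlane.comeasToQMat_qmatToComeas q x⟩, ?_, ?_,
    Function.LeftInverse.injective (QuantumPlane.comeasToQMat_qmatToComeas q),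
    QuantumPlane.qmatToComeas_mGen q, ?_, QuantumPlane.comeasToQMat_qmatToComeas q,
    QuantumPlane.comeasForm_isDualQuasitriangular q, QuantumPlane.comeasForm_tGen q,
    QuantumPlane.qmatForm_isDualQuasitriangular q, QuantumPlane.qmatForm_mGen q, ?_⟩
  · intro i j
    rw [QuantumPlane.comeasToQMat_tGen, QuantumPlane.coactionMat_low]
  · intro I j hI
    rw [QuantumPlane.comeasToQMat_tGen, QuantumPlane.coactionMat_eq_zero]
    have hj : QuantumPlane.deg (QuantumPlane.low j) = 1 := by revert j; decide
    omega
  · rw [← Algebra.map_top, ← QuantumPlane.adjoin_range_mGen, AlgHom.map_adjoin, ← Set.range_comp]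
    congr 2
    funext ij
    exact QuantumPlane.qmatToComeas_mGen q ij.1 ij.2
  · intro x y
    rw [QuantumPlane.comeasForm_apply, QuantumPlane.comeasToQMat_qmatToComeas,
      QuantumPlane.comeasToQMat_qmatToComeas]
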